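/- Consider a data-generating system $y(t)=G^0(q)u(t)+H^0(q)e(t)$, $t\in\mathbb Z$, with $q$ the forward shift, $y(t),e(t)\in\mathbb R^p$, $u(t)\in\mathbb R^m$, where $G^0$ is a proper stable real rational transfer matrix, $H^0$ is a rational noise model that is monic (proper with $H^0(\infty)=I$), stable and stably invertible, $e$ is a vector white-noise process, $e(t)$ is uncorrelated with $u(s)$ for all $s\le t$, and $\kappa(t)=\begin{bmatrix}u(t)\\ e(t)\end{bmatrix}$ is quasi-stationary: its second moments are uniformly bounded and $R_\kappa(\tau)=\bar{\mathbb E}\,\kappa(t)\kappa(t-\tau)^T$ exists for all $\tau$, where $\bar{\mathbb E}f(t)=\lim_{N\to\infty}\frac1N\sum_{t=1}^N\mathbb E f(t)$. Let $(G(q,\theta),H(q,\theta))_{\theta\in\Theta}$, $\Theta\subset\mathbb R^n$, be a parametrized model with $G(q,\theta)$ rational, proper and stable and $H(q,\theta)$ rational, monic, stable and stably invertible for each $\theta\in\Theta$. Put $M(q,\theta)=[G(q,\theta)\ \ H(q,\theta)]$ and $M^0=[G^0\ \ H^0]$, and suppose that the system is in the model set, i.e. $M(q,\theta_0)=M^0(q)$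 for some $\theta_0\in\Theta$. Let $\varepsilon(t,\theta)=y(t)-\hat y(t|t-1;\theta)=H(q,\theta)^{-1}[y(t)-G(q,\theta)u(t)]$ be the one-step-ahead prediction error, with $\hat y(t|t-1;\theta)=(I-H(q,\theta)^{-1})y(t)+H(q,\theta)^{-1}G(q,\theta)u(t)$, and let $V(\theta)=\bar{\mathbb E}\,\varepsilon^T(t,\theta)Q\varepsilon(t,\theta)$ be the cost, with $Q$ a positive definite weighting matrix. Fix a row index $j$ and suppose that row $M_j(q,\theta)$ shares no parameters with the other rows: there is a set $I$ of parameter indices such that on $\Theta$ row $j$ depends only on the $\theta_i$ with $i\in I$ and the other rows depend only on the $\theta_i$ with $i\notin I$. Let $\kappa^{[j]}$ consist of the components of $\kappa$ that correspond either to the columns of those entries of row $M_j(q,\theta)$ that are not identically zero over $\Theta$, or just to the columns of the parametrized entries of that row, i.e. those that are not one and the same transfer function for all $\theta\in\Theta$. Suppose that $\kappa^{[j]}$ has a spectral density, i.e. an integrable matrix function $\Phi_{\kappa^{[j]}}$ on $(-\pi,\pi]$ with $\bar{\mathbb E}\,\kappa^{[j]}(t)\kappa^{[j]}(t-\tau)^T=\frac1{2\pi}\int_{-\pi}^{\pi}\Phi_{\kappa^{[j]}}(\omega)e^{i\omega\tau}\,d\omega$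 for all $\tau\in\mathbb Z$, and that $\Phi_{\kappa^{[j]}}(\omega)\succ0$ for almost all $\omega$. Then $V(\theta)$ exists for every $\theta\in\Theta$, and $M_j(q,\theta)=M_j^0(q)$ is unique at the minimum of $V$ over $\Theta$: $V$ has a minimizer in $\Theta$, and every minimizer $\theta^*\in\Theta$ satisfies $M_j(q,\theta^*)=M_j^0(q)$. -/

import Mathlib

open MeasureTheory Filter Topology
open scoped ComplexOrder

noncomputable section

namespace PredErr

/-! ### Rational transfer functions in the forward shift `q` -/

/-- The expansion of a rational function of `q` in the field of Laurent series in `q⁻¹`: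
`HahnSeries.single 1 1` is `q⁻¹`, so that `q` is sent to `HahnSeries.single (-1) 1`. -/
def expansion (F : RatFunc ℝ) : LaurentSeries ℝ :=
  F.eval (HahnSeries.C : ℝ →+* LaurentSeries ℝ) (HahnSeries.single (-1 : ℤ) (1 : ℝ))

/-- The impulse response of `F`: the coefficient of `q ^ (-k)` in the expansion of `F`. -/
def impulse (F : RatFunc ℝ) (k : ℕ) : ℝ :=
  HahnSeries.coeff (expansion F) (k : ℤ)

/-- `F` is proper: it has no pole at infinity. -/
def IsProper (F : RatFunc ℝ) : Prop :=
  F.num.natDegree ≤ F.denom.natDegree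

/-- `F` is (causal and) stable: it is proper and all its poles lie in the open unit disc. -/
def IsStable (F : RatFunc ℝ) : Prop :=
  IsProper F ∧ ∀ z : ℂ, 1 ≤ ‖z‖ → Polynomial.aeval z F.denom ≠ 0

/-- A transfer matrix is stable if all its entries are. -/
def IsStableMatrix {α β : Type*} (F : Matrix α β (RatFunc ℝ)) : Prop :=
  ∀ a b, IsStable (F a b)

/-- A square transfer matrix is monic if it is proper with value the identity matrix at `q = ∞`. -/
def IsMonic {p : ℕ} (H : Matrix (Fin p) (Fin p) (RatFunc ℝ)) : Prop :=
  (∀ a b, IsProper (H a b)) ∧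
    ∀ a b, impulse (H a b) 0 = (1 : Matrix (Fin p) (Fin p) ℝ) a b

/-- Noise models: monic, stable and stably invertible. -/
structure IsNoiseModel {p : ℕ} (H : Matrix (Fin p) (Fin p) (RatFunc ℝ)) : Prop where
  monic : IsMonic H
  stable : IsStableMatrix H
  invertible : IsUnit H.det
  stable_inv : IsStableMatrix H⁻¹

/-! ### Signals, filtering and generalized expectation -/

/-- The filtered signal `(F(q) s)(t) = ∑_{k ≥ 0} f(k) s(t - k)`, with `f` the impulse response
of the transfer matrix `F`. -/
def filt {Ω α β : Type*} [Fintype β] (F : Matrix α β (RatFunc ℝ)) (s : ℤ → Ω → β → ℝ) :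
    ℤ → Ω → α → ℝ :=
  fun t ω a => ∑ b, ∑' k : ℕ, impulse (F a b) k * s (t - k) ω b

/-- `f` has generalized expectation `L`, that is
`lim_{N → ∞} (1 / N) ∑_{t = 1}^N 𝔼 f(t) = L`, all the expectations being well defined. -/
def HasGenExp {Ω : Type*} [MeasurableSpace Ω] (P : Measure Ω) (f : ℤ → Ω → ℝ) (L : ℝ) : Prop :=
  (∀ t, Integrable (f t) P) ∧
    Tendsto (fun N : ℕ => (N : ℝ)⁻¹ * ∑ t ∈ Finset.Icc 1 N, ∫ ω, f (t : ℤ) ω ∂P) atTop (𝓝 L)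

/-- `R(τ)` is the generalized expectation of `s(t) s(t - τ)ᵀ`, for every `τ`. -/
def HasCovariance {Ω ι : Type*} [MeasurableSpace Ω] (P : Measure Ω) (s : ℤ → Ω → ι → ℝ)
    (R : ℤ → Matrix ι ι ℝ) : Prop :=
  ∀ τ a b, HasGenExp P (fun t ω => s t ω a * s (t - τ) ω b) (R τ a b)

/-- Quasi-stationary vector signals: uniformly bounded second moments, and the time averages
that define the covariance function converge. A deterministic signal is one that does not depend
on `ω`. -/
structure IsQuasiStationary {Ω ι : Type*} [MeasurableSpace Ω] (P : Measure Ω)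
    (s : ℤ → Ω → ι → ℝ) : Prop where
  memLp : ∀ t a, MemLp (fun ω => s t ω a) 2 P
  bounded : ∃ C : ℝ, ∀ t a, ∫ ω, s t ω a ^ 2 ∂P ≤ C
  covariance : ∃ R : ℤ → Matrix ι ι ℝ, HasCovariance P s R

/-- `Φ` is the spectral density of the signal `s`: an integrable function on `(-π, π]` such that
the covariance function of `s` is
`R(τ) = (1 / 2π) ∫_{-π}^{π} Φ(ω) exp(iωτ) dω`
(`Φ(ω) = ∑_τ R(τ) exp(-iωτ)` whenever `R` is absolutely summable). -/
def HasSpectralDensity {Ω ι : Type*} [MeasurableSpace Ω] (P : Measure Ω)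
    (s : ℤ → Ω → ι → ℝ) (Φ : ℝ → Matrix ι ι ℂ) : Prop :=
  (∀ a b, IntegrableOn (fun w => Φ w a b) (Set.Ioc (-Real.pi) Real.pi)) ∧
    ∃ R : ℤ → Matrix ι ι ℝ, HasCovariance P s R ∧
      ∀ τ a b, ((R τ a b : ℝ) : ℂ) =
        (2 * (Real.pi : ℂ))⁻¹ *
          ∫ w in (-Real.pi)..Real.pi, Φ w a b * Complex.exp (Complex.I * w * τ)

/-- Vector white noise with covariance matrix `Λ`. -/
structure IsWhiteNoise {Ω ι : Type*} [MeasurableSpace Ω] (P : Measure Ω)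
    (e : ℤ → Ω → ι → ℝ) (Λ : Matrix ι ι ℝ) : Prop where
  memLp : ∀ t a, MemLp (fun ω => e t ω a) 2 P
  mean_zero : ∀ t a, ∫ ω, e t ω a ∂P = 0
  covariance : ∀ t a b, ∫ ω, e t ω a * e t ω b ∂P = Λ a b
  uncorrelated : ∀ s t, s ≠ t → ∀ a b, ∫ ω, e s ω a * e t ω b ∂P = 0

/-- The signal `κ(t)`, composed of `u(t)` and `e(t)`. -/
def kappa {Ω : Type*} {m p : ℕ} (u : ℤ → Ω → Fin m → ℝ) (e : ℤ → Ω → Fin p → ℝ) :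
    ℤ → Ω → Fin m ⊕ Fin p → ℝ :=
  fun t ω => Sum.elim (u t ω) (e t ω)

/-- The selection of the components of a vector signal with index in `S`. -/
def select {Ω ι : Type*} (S : Set ι) (s : ℤ → Ω → ι → ℝ) : ℤ → Ω → S → ℝ :=
  fun t ω c => s t ω c

/-! ### Predictor, prediction error and cost -/

/-- The one-step-ahead predictor `ŷ = (I - H⁻¹) y + H⁻¹ G u` of the model `(G, H)`. -/
def predictor {Ω : Type*} {m p : ℕ} (G : Matrix (Fin p) (Fin m) (RatFunc ℝ))
    (H : Matrix (Fin p) (Fin p) (RatFunc ℝ)) (y : ℤ → Ω → Fin p → ℝ) (u : ℤ → Ω → Fin m → ℝ) :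
    ℤ → Ω → Fin p → ℝ :=
  fun t ω => filt (1 - H⁻¹) y t ω + filt (H⁻¹ * G) u t ω

/-- The one-step-ahead prediction error `ε = y - ŷ`. -/
def predictionError {Ω : Type*} {m p : ℕ} (G : Matrix (Fin p) (Fin m) (RatFunc ℝ))
    (H : Matrix (Fin p) (Fin p) (RatFunc ℝ)) (y : ℤ → Ω → Fin p → ℝ) (u : ℤ → Ω → Fin m → ℝ) :
    ℤ → Ω → Fin p → ℝ :=
  fun t ω => y t ω - predictor G H y u t ω

/-- `V` is the prediction-error cost on the parameter set `Θ`: for every `θ ∈ Θ`, the generalized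
expectation of `ε(t, θ)ᵀ Q ε(t, θ)` exists and equals `V θ`. -/
def IsPredictionErrorCost {Ω : Type*} [MeasurableSpace Ω] (P : Measure Ω) {m p n : ℕ}
    (Θ : Set (Fin n → ℝ)) (G : (Fin n → ℝ) → Matrix (Fin p) (Fin m) (RatFunc ℝ))
    (H : (Fin n → ℝ) → Matrix (Fin p) (Fin p) (RatFunc ℝ)) (Q : Matrix (Fin p) (Fin p) ℝ)
    (y : ℤ → Ω → Fin p → ℝ) (u : ℤ → Ω → Fin m → ℝ) (V : (Fin n → ℝ) → ℝ) : Prop :=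
  ∀ θ ∈ Θ, HasGenExp P
    (fun t ω => predictionError (G θ) (H θ) y u t ω ⬝ᵥ
      Q.mulVec (predictionError (G θ) (H θ) y u t ω)) (V θ)

/-! ### Structure of the parametrized model -/

/-- `M(q, θ) = [G(q, θ)  H(q, θ)]`. -/
def modelMatrix {m p n : ℕ} (G : (Fin n → ℝ) → Matrix (Fin p) (Fin m) (RatFunc ℝ))
    (H : (Fin n → ℝ) → Matrix (Fin p) (Fin p) (RatFunc ℝ)) :
    (Fin n → ℝ) → Matrix (Fin p) (Fin m ⊕ Fin p) (RatFunc ℝ) :=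
  fun θ => Matrix.fromCols (G θ) (H θ)

/-- The parameters in row `j` are not shared with the other rows: there is a set `S` of parameter
indices such that row `j` depends only on the `θ i` with `i ∈ S`, and the other rows depend only on
the `θ i` with `i ∉ S`. -/
def RowIndependent {n : ℕ} {α β γ : Type*} (Θ : Set (Fin n → ℝ))
    (M : (Fin n → ℝ) → Matrix α β γ) (j : α) : Prop :=
  ∃ S : Set (Fin n),
    (∀ θ ∈ Θ, ∀ θ' ∈ Θ, (∀ i ∈ S, θ i = θ' i) → M θ j = M θ' j) ∧
    (∀ θ ∈ Θ, ∀ θ' ∈ Θ, (∀ i ∉ S, θ i = θ' i) → ∀ l, l ≠ j → M θ l = M θ' l)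

/-- The columns of the entries of row `j` that are not structurally zero. -/
def nonzeroColumns {n : ℕ} {α β γ : Type*} [Zero γ] (Θ : Set (Fin n → ℝ))
    (M : (Fin n → ℝ) → Matrix α β γ) (j : α) : Set β :=
  {c | ∃ θ ∈ Θ, M θ j c ≠ 0}

/-- The columns of the parametrized entries of row `j`, that is, of those entries that are not
one and the same (a priori known) transfer function for all `θ ∈ Θ`. -/
def parametrizedColumns {n : ℕ} {α β γ : Type*} (Θ : Set (Fin n → ℝ))
    (M : (Fin n → ℝ) → Matrix α β γ) (j : α) : Set β :=
  {c | ∃ θ ∈ Θ, ∃ θ' ∈ Θ, M θ j c ≠ M θ' j c}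

end PredErr

end

/-! Write `κ = (u, e)`. Substituting the system into the predictor gives `ε = e + H(θ)⁻¹ (M⁰ - M(θ))
κ` (`predictionError_filterMat`). Since `H⁰` and `H(θ)` are both monic, the second term involves
only `u` up to time `t` and the strict past of `e` (`impulse_zero_mismatch`), so it is uncorrelated
with `e(t)` (`avg_noise_filterMat_eq_zero`). Hence `V(θ)` is a constant plus the `Q`-weighted power
of the filtered mismatch. That power is nonnegative and vanishes at `θ₀`, so a minimizer is exactly
a parameter at which it is zero.

At a minimizer, positive definiteness of `Q` makes every component of `H(θ)⁻¹ (M⁰ - M(θ)) κ`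
negligible in quadratic mean. Stable filters preserve negligibility, so applying `H(θ)` makes row
`j` of `(M⁰ - M(θ)) κ` negligible. Entries of this row outside `S` vanish, and the power of the
remaining part is `(1/2π) ∫ x* Φ x`, with `x` the vector of frequency responses. As `Φ` is positive
definite almost everywhere, `x = 0` almost everywhere, and Fourier coefficients give a zero impulse
response (`eq_zero_of_isNegligible_of_hasSpectralDensity`).

Analytically, signals are bounded sequences in `L²(P)` and stable filters are absolutely convergent
series of delays in a Banach algebra of operators. Algebra of transfer functions thus becomes
algebra of operators, and dominated convergence exchanges time averages with filtering. -/

noncomputable section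

namespace PredErr

/-! ### Absolutely summable power series -/

/-- Power series with absolutely summable coefficients. -/
def SummableCoeff {𝕜 : Type*} [NormedField 𝕜] (f : PowerSeries 𝕜) : Prop :=
  Summable fun k => ‖PowerSeries.coeff k f‖

theorem SummableCoeff.coe_polynomial {𝕜 : Type*} [NormedField 𝕜] (p : Polynomial 𝕜) :
    SummableCoeff (p : PowerSeries 𝕜) := by
  refine summable_of_ne_finset_zero (s := p.support) fun k hk => ?_
  simp [Polynomial.notMem_support_iff.1 hk]

theorem SummableCoeff.add {𝕜 : Type*} [NormedField 𝕜] {f g : PowerSeries 𝕜}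
    (hf : SummableCoeff f) (hg : SummableCoeff g) : SummableCoeff (f + g) := by
  refine Summable.of_nonneg_of_le (fun _ => norm_nonneg _) (fun k => ?_) (Summable.add hf hg)
  simpa using norm_add_le _ _

theorem SummableCoeff.neg {𝕜 : Type*} [NormedField 𝕜] {f : PowerSeries 𝕜}
    (hf : SummableCoeff f) : SummableCoeff (-f) := by
  simpa [SummableCoeff] using hf

theorem SummableCoeff.mul {𝕜 : Type*} [NormedField 𝕜] {f g : PowerSeries 𝕜}
    (hf : SummableCoeff f) (hg : SummableCoeff g) : SummableCoeff (f * g) := by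
  simpa [SummableCoeff, PowerSeries.coeff_mul] using
    summable_norm_sum_mul_antidiagonal_of_summable_norm hf hg

/-- Up to a constant the reversed polynomial is a product of factors `1 - zX` over the roots `z` of
`D`. Each is inverted by a geometric series, summable because `‖z‖ < 1`, and summability survives
Cauchy products. -/
theorem exists_summableCoeff_mul_reverse_eq_one {D : Polynomial ℂ} (hD : D ≠ 0)
    (hroots : ∀ z ∈ D.roots, ‖z‖ < 1) :
    ∃ f : PowerSeries ℂ, SummableCoeff f ∧ f * (D.reverse : PowerSeries ℂ) = 1 := by
  have hfac := (IsAlgClosed.splits D).eq_prod_roots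
  rw [hfac, Polynomial.reverse_mul_of_domain, Polynomial.reverse_C]
  have hprod : ∀ s : Multiset ℂ, (∀ z ∈ s, ‖z‖ < 1) → ∃ f : PowerSeries ℂ, SummableCoeff f ∧
      f * ((s.map fun z => Polynomial.X - Polynomial.C z).prod.reverse : PowerSeries ℂ) = 1 := by
    intro s
    induction s using Multiset.induction_on with
    | empty =>
      intro _
      refine ⟨1, ?_, ?_⟩
      · simpa using SummableCoeff.coe_polynomial (1 : Polynomial ℂ)
      · rw [Multiset.map_zero, Multiset.prod_zero, ← Polynomial.C_1, Polynomial.reverse_C]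
        simp
    | cons z s ih =>
      intro h
      obtain ⟨f, hf, hfs⟩ := ih fun w hw => h w (Multiset.mem_cons_of_mem hw)
      have hz : ‖z‖ < 1 := h z (Multiset.mem_cons_self _ _)
      have hrev : (Polynomial.X - Polynomial.C z).reverse =
          1 - Polynomial.C z * Polynomial.X := by
        rw [Polynomial.reverse, Polynomial.natDegree_X_sub_C, Polynomial.reflect_sub]
        have hX : Polynomial.reflect 1 (Polynomial.X : Polynomial ℂ) = 1 := by
          simp
        rw [hX, Polynomial.reflect_C, pow_one]
      refine ⟨PowerSeries.mk (fun k => z ^ k) * f, SummableCoeff.mul ?_ hf, ?_⟩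
      · simpa [SummableCoeff] using summable_geometric_of_lt_one (norm_nonneg z) hz
      · have hgeom : PowerSeries.mk (fun k => z ^ k) *
            ((1 - Polynomial.C z * Polynomial.X : Polynomial ℂ) : PowerSeries ℂ) = 1 := by
          ext k
          cases k with
          | zero => simp [mul_sub]
          | succ k =>
            simp [mul_sub, PowerSeries.coeff_one]
            rw [← mul_assoc, PowerSeries.coeff_succ_mul_X]
            simp [pow_succ]
        rw [Multiset.map_cons, Multiset.prod_cons, Polynomial.reverse_mul_of_domain,
          Polynomial.coe_mul, hrev, mul_mul_mul_comm, hgeom, hfs, one_mul]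
  obtain ⟨f, hf, hfs⟩ := hprod D.roots hroots
  have hlc : D.leadingCoeff ≠ 0 := Polynomial.leadingCoeff_ne_zero.2 hD
  refine ⟨((Polynomial.C D.leadingCoeff⁻¹ : Polynomial ℂ) : PowerSeries ℂ) * f,
    (SummableCoeff.coe_polynomial _).mul hf, ?_⟩
  rw [Polynomial.coe_mul, mul_mul_mul_comm, hfs, ← Polynomial.coe_mul, ← Polynomial.C_mul,
    inv_mul_cancel₀ hlc]
  simp

/-- The formal inverse exists over `ℝ`, since the constant term of the reverse is the nonzero
leading coefficient of `D`. By uniqueness of inverses its image over `ℂ` is the summable one. -/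
theorem exists_real_summableCoeff_mul_reverse_eq_one {D : Polynomial ℝ} (hD : D ≠ 0)
    (hroots : ∀ z : ℂ, 1 ≤ ‖z‖ → Polynomial.aeval z D ≠ 0) :
    ∃ f : PowerSeries ℝ, SummableCoeff f ∧ f * (D.reverse : PowerSeries ℝ) = 1 := by
  have hinj : Function.Injective (algebraMap ℝ ℂ) := (algebraMap ℝ ℂ).injective
  have hmap : D.map (algebraMap ℝ ℂ) ≠ 0 := (Polynomial.map_ne_zero_iff hinj).2 hD
  obtain ⟨g, hg, hg1⟩ := exists_summableCoeff_mul_reverse_eq_one hmap fun z hz => by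
    by_contra hcon
    refine hroots z (not_lt.1 hcon) ?_
    have := (Polynomial.mem_roots hmap).1 hz
    rwa [Polynomial.IsRoot.def, Polynomial.eval_map_algebraMap] at this
  have hrev : (D.map (algebraMap ℝ ℂ)).reverse = D.reverse.map (algebraMap ℝ ℂ) := by
    ext k
    simp [Polynomial.coeff_reverse]
  have hcoe : ((D.reverse.map (algebraMap ℝ ℂ) : Polynomial ℂ) : PowerSeries ℂ) =
      PowerSeries.map (algebraMap ℝ ℂ) (D.reverse : PowerSeries ℝ) := by
    ext k
    simp
  have hinv : (D.reverse : PowerSeries ℝ)⁻¹ * (D.reverse : PowerSeries ℝ) = 1 := by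
    refine PowerSeries.inv_mul_cancel _ ?_
    rw [← PowerSeries.coeff_zero_eq_constantCoeff_apply, Polynomial.coeff_coe,
      Polynomial.coeff_zero_reverse]
    exact Polynomial.leadingCoeff_ne_zero.2 hD
  have hgeq : g = PowerSeries.map (algebraMap ℝ ℂ) (D.reverse : PowerSeries ℝ)⁻¹ := by
    have h2 := congrArg (PowerSeries.map (algebraMap ℝ ℂ)) hinv
    rw [map_mul, map_one] at h2
    rw [hrev, hcoe] at hg1
    calc g = g * (PowerSeries.map (algebraMap ℝ ℂ) (D.reverse : PowerSeries ℝ)⁻¹ *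
          PowerSeries.map (algebraMap ℝ ℂ) (D.reverse : PowerSeries ℝ)) := by rw [h2, mul_one]
      _ = _ := by rw [mul_left_comm, hg1, mul_one]
  refine ⟨_, ?_, hinv⟩
  simpa [SummableCoeff, hgeq] using hg

/-! ### Expansions of transfer functions -/

theorem eval₂_single_one (p : Polynomial ℝ) :
    p.eval₂ (HahnSeries.C : ℝ →+* LaurentSeries ℝ) (HahnSeries.single (1 : ℤ) (1 : ℝ)) =
      HahnSeries.ofPowerSeries ℤ ℝ (p : PowerSeries ℝ) := by
  have h : Polynomial.eval₂RingHom (HahnSeries.C : ℝ →+* LaurentSeries ℝ)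
      (HahnSeries.single (1 : ℤ) (1 : ℝ)) =
      (HahnSeries.ofPowerSeries ℤ ℝ).comp Polynomial.coeToPowerSeries.ringHom := by
    ext r
    · simp
    · simp
  exact congrArg (fun φ => φ p) h

instance invertibleSingleNegOne :
    Invertible (HahnSeries.single (-1 : ℤ) (1 : ℝ) : LaurentSeries ℝ) where
  invOf := HahnSeries.single (1 : ℤ) (1 : ℝ)
  invOf_mul_self := by simp
  mul_invOf_self := by simp

/-- Factoring `q ^ N` out of a polynomial in `q` leaves a polynomial in `q⁻¹`. The exponent is free
so that numerator and denominator can share it and it cancels in the quotient. -/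
theorem eval₂_single_neg_one (N : ℕ) {p : Polynomial ℝ} (hp : p.natDegree ≤ N) :
    p.eval₂ (HahnSeries.C : ℝ →+* LaurentSeries ℝ) (HahnSeries.single (-1 : ℤ) (1 : ℝ)) =
      HahnSeries.ofPowerSeries ℤ ℝ (p.reflect N : PowerSeries ℝ) *
        HahnSeries.single (-1 : ℤ) (1 : ℝ) ^ N := by
  rw [← Polynomial.eval₂_reflect_mul_pow _ _ N p hp, ← eval₂_single_one]
  rfl

theorem eval₂_single_neg_one_injective : Function.Injective
    (Polynomial.eval₂RingHom (HahnSeries.C : ℝ →+* LaurentSeries ℝ)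
      (HahnSeries.single (-1 : ℤ) (1 : ℝ))) := by
  refine (injective_iff_map_eq_zero _).2 fun p hp => ?_
  rw [Polynomial.coe_eval₂RingHom, eval₂_single_neg_one p.natDegree le_rfl,
    mul_eq_zero, or_iff_left (pow_ne_zero _ (by simp))] at hp
  have h0 := HahnSeries.ofPowerSeries_injective (hp.trans (map_zero _).symm)
  rw [← Polynomial.reverse, Polynomial.coe_eq_zero_iff, Polynomial.reverse_eq_zero] at h0
  exact h0

/-- The expansion at infinity as a homomorphism of fields. -/
def expansionHom : RatFunc ℝ →+* LaurentSeries ℝ :=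
  RatFunc.liftRingHom _
    (nonZeroDivisors_le_comap_nonZeroDivisors_of_injective _ eval₂_single_neg_one_injective)

/-- `RatFunc.eval` respects sums and products only when denominators do not vanish. Here none does,
since `q` is transcendental; the algebraic rules for `expansion` rest on this identification. -/
theorem expansion_eq (F : RatFunc ℝ) : expansion F = expansionHom F := by
  rw [expansionHom, RatFunc.liftRingHom_apply]
  rfl

theorem expansion_injective : Function.Injective expansion := by
  intro F F' h
  rw [expansion_eq, expansion_eq] at h
  exact expansionHom.injective h

/-- The expansion of `F` is a power series in `q⁻¹` with absolutely summable coefficients. -/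
def HasSummableExpansion (F : RatFunc ℝ) : Prop :=
  ∃ f : PowerSeries ℝ, SummableCoeff f ∧ expansion F = HahnSeries.ofPowerSeries ℤ ℝ f

theorem impulse_eq_coeff {F : RatFunc ℝ} {f : PowerSeries ℝ}
    (h : expansion F = HahnSeries.ofPowerSeries ℤ ℝ f) (k : ℕ) :
    impulse F k = PowerSeries.coeff k f := by
  rw [impulse, h, LaurentSeries.coeff_coe_powerSeries]

namespace HasSummableExpansion

variable {F F' : RatFunc ℝ}

theorem summable (hF : HasSummableExpansion F) : Summable fun k => ‖impulse F k‖ := by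
  obtain ⟨f, hf, h⟩ := hF
  simp only [impulse_eq_coeff h]
  exact hf

theorem zero : HasSummableExpansion 0 :=
  ⟨0, by simpa using SummableCoeff.coe_polynomial (0 : Polynomial ℝ), by simp [expansion_eq]⟩

theorem one : HasSummableExpansion 1 :=
  ⟨1, by simpa using SummableCoeff.coe_polynomial (1 : Polynomial ℝ), by simp [expansion_eq]⟩

theorem add (hF : HasSummableExpansion F) (hF' : HasSummableExpansion F') :
    HasSummableExpansion (F + F') := by
  obtain ⟨f, hf, h⟩ := hF
  obtain ⟨f', hf', h'⟩ := hF'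
  exact ⟨f + f', hf.add hf', by rw [expansion_eq, map_add, map_add, ← h, ← h', expansion_eq,
    expansion_eq]⟩

theorem neg (hF : HasSummableExpansion F) : HasSummableExpansion (-F) := by
  obtain ⟨f, hf, h⟩ := hF
  exact ⟨-f, hf.neg, by rw [expansion_eq, map_neg, map_neg, ← h, expansion_eq]⟩

theorem sub (hF : HasSummableExpansion F) (hF' : HasSummableExpansion F') :
    HasSummableExpansion (F - F') := by
  rw [sub_eq_add_neg]
  exact hF.add hF'.neg

theorem mul (hF : HasSummableExpansion F) (hF' : HasSummableExpansion F') :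
    HasSummableExpansion (F * F') := by
  obtain ⟨f, hf, h⟩ := hF
  obtain ⟨f', hf', h'⟩ := hF'
  exact ⟨f * f', hf.mul hf', by rw [expansion_eq, map_mul, map_mul, ← h, ← h', expansion_eq,
    expansion_eq]⟩

theorem sum {ι : Type*} {s : Finset ι} {F : ι → RatFunc ℝ}
    (hF : ∀ i ∈ s, HasSummableExpansion (F i)) : HasSummableExpansion (∑ i ∈ s, F i) :=
  Finset.sum_induction _ _ (fun _ _ => add) zero hF

theorem impulse_mul (hF : HasSummableExpansion F) (hF' : HasSummableExpansion F') (k : ℕ) :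
    impulse (F * F') k =
      ∑ ij ∈ Finset.HasAntidiagonal.antidiagonal k, impulse F ij.1 * impulse F' ij.2 := by
  obtain ⟨f, hf, h⟩ := hF
  obtain ⟨f', hf', h'⟩ := hF'
  have hmul : expansion (F * F') = HahnSeries.ofPowerSeries ℤ ℝ (f * f') := by
    rw [expansion_eq, map_mul, map_mul, ← h, ← h', expansion_eq, expansion_eq]
  simp only [impulse_eq_coeff hmul, impulse_eq_coeff h, impulse_eq_coeff h', PowerSeries.coeff_mul]

theorem eq_zero_of_impulse (hF : HasSummableExpansion F) (h0 : ∀ k, impulse F k = 0) : F = 0 := by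
  obtain ⟨f, hf, h⟩ := hF
  have hf0 : f = 0 := by
    ext k
    simpa [impulse_eq_coeff h] using h0 k
  refine expansion_injective ?_
  rw [h, hf0, map_zero, expansion_eq, map_zero]

end HasSummableExpansion

theorem impulse_add (F F' : RatFunc ℝ) (k : ℕ) :
    impulse (F + F') k = impulse F k + impulse F' k := by
  simp [impulse, expansion_eq]

theorem impulse_sub (F F' : RatFunc ℝ) (k : ℕ) :
    impulse (F - F') k = impulse F k - impulse F' k := by
  simp [impulse, expansion_eq]

theorem impulse_zero (k : ℕ) : impulse 0 k = 0 := by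
  simp [impulse, expansion_eq]

theorem impulse_one (k : ℕ) : impulse 1 k = if k = 0 then 1 else 0 := by
  simp [impulse, expansion_eq, HahnSeries.coeff_one]

theorem IsStable.hasSummableExpansion {F : RatFunc ℝ} (hF : IsStable F) :
    HasSummableExpansion F := by
  obtain ⟨f, hf, hf1⟩ := exists_real_summableCoeff_mul_reverse_eq_one F.denom_ne_zero hF.2
  refine ⟨(F.num.reflect F.denom.natDegree : PowerSeries ℝ) * f,
    (SummableCoeff.coe_polynomial _).mul hf, ?_⟩
  have hq : (HahnSeries.single (-1 : ℤ) (1 : ℝ) : LaurentSeries ℝ) ^ F.denom.natDegree ≠ 0 :=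
    pow_ne_zero _ (by simp)
  have hden := congrArg (HahnSeries.ofPowerSeries ℤ ℝ) hf1
  rw [map_mul, map_one] at hden
  rw [expansion, RatFunc.eval, eval₂_single_neg_one _ hF.1,
    eval₂_single_neg_one F.denom.natDegree le_rfl, mul_div_mul_right _ _ hq, map_mul,
    ← Polynomial.reverse, div_eq_iff (right_ne_zero_of_mul_eq_one hden), mul_assoc, hden, mul_one]

open scoped BoundedContinuousFunction RealInnerProductSpace

variable {E : Type*} [NormedAddCommGroup E]

/-! ### Filters acting on bounded sequences -/

section Operators

variable [NormedSpace ℝ E]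

/-- The delay by `k` time units. -/
def delay (k : ℤ) : (ℤ →ᵇ E) →L[ℝ] (ℤ →ᵇ E) :=
  BoundedContinuousFunction.compContinuousCLM E ℝ
    ⟨fun t : ℤ => t - k, continuous_of_discreteTopology⟩

@[simp]
theorem delay_apply (k : ℤ) (x : ℤ →ᵇ E) (t : ℤ) : delay k x t = x (t - k) := rfl

theorem norm_delay_le (k : ℤ) : ‖(delay k : (ℤ →ᵇ E) →L[ℝ] (ℤ →ᵇ E))‖ ≤ 1 :=
  BoundedContinuousFunction.norm_compContinuousCLM_le_one _

theorem norm_delay_apply_le (k : ℤ) (x : ℤ →ᵇ E) : ‖delay k x‖ ≤ ‖x‖ :=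
  BoundedContinuousFunction.norm_compContinuous_le x _

theorem delay_delay (k l : ℤ) (x : ℤ →ᵇ E) : delay k (delay l x) = delay (k + l) x := by
  ext t
  simp [sub_sub]

theorem delay_mul (k l : ℤ) :
    (delay k * delay l : (ℤ →ᵇ E) →L[ℝ] (ℤ →ᵇ E)) = delay (k + l) := by
  ext1 x
  exact delay_delay k l x

@[simp]
theorem delay_zero (x : ℤ →ᵇ E) : delay 0 x = x := by
  ext t
  simp

/-- The filter with transfer function `F`, as an operator on bounded sequences. -/
def filterOp (F : RatFunc ℝ) : (ℤ →ᵇ E) →L[ℝ] (ℤ →ᵇ E) :=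
  ∑' k : ℕ, impulse F k • delay (k : ℤ)

/-- The filter with transfer matrix `F`, as an operator on bounded vector sequences. -/
def filterMat {α β : Type*} [Fintype β] (F : Matrix α β (RatFunc ℝ)) (s : β → ℤ →ᵇ E) :
    α → ℤ →ᵇ E :=
  fun a => ∑ b, filterOp (F a b) (s b)

/-- Delays are contractions, so a summable impulse response gives absolute convergence in operator
norm. This is what makes the series defining `filterOp` meaningful. -/
theorem summable_norm_smul_delay {F : RatFunc ℝ} (hF : HasSummableExpansion F) :
    Summable fun k : ℕ => ‖impulse F k • (delay (k : ℤ) : (ℤ →ᵇ E) →L[ℝ] (ℤ →ᵇ E))‖ := by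
  refine Summable.of_nonneg_of_le (fun _ => norm_nonneg _) (fun k => ?_) hF.summable
  rw [norm_smul]
  exact mul_le_of_le_one_right (norm_nonneg _) (norm_delay_le _)

variable [CompleteSpace E]

theorem summable_smul_delay {F : RatFunc ℝ} (hF : HasSummableExpansion F) :
    Summable fun k : ℕ => impulse F k • (delay (k : ℤ) : (ℤ →ᵇ E) →L[ℝ] (ℤ →ᵇ E)) :=
  Summable.of_norm (summable_norm_smul_delay hF)

theorem filterOp_hasSum {F : RatFunc ℝ} (hF : HasSummableExpansion F) (x : ℤ →ᵇ E) :
    HasSum (fun k : ℕ => impulse F k • delay (k : ℤ) x) (filterOp F x) := by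
  have h := (summable_smul_delay (E := E) hF).hasSum
  exact h.mapL (ContinuousLinearMap.apply ℝ (ℤ →ᵇ E) x)

theorem filterOp_apply {F : RatFunc ℝ} (hF : HasSummableExpansion F) (x : ℤ →ᵇ E) (t : ℤ) :
    filterOp F x t = ∑' k : ℕ, impulse F k • x (t - k) :=
  ((filterOp_hasSum hF x).mapL
    (BoundedContinuousFunction.evalCLM ℝ t : (ℤ →ᵇ E) →L[ℝ] E)).tsum_eq.symm

omit [CompleteSpace E] in
theorem filterOp_zero : (filterOp 0 : (ℤ →ᵇ E) →L[ℝ] (ℤ →ᵇ E)) = 0 := by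
  simp [filterOp, impulse_zero]

omit [CompleteSpace E] in
theorem filterOp_one : (filterOp 1 : (ℤ →ᵇ E) →L[ℝ] (ℤ →ᵇ E)) = 1 := by
  rw [filterOp, tsum_eq_single 0 fun k hk => by simp [impulse_one, hk]]
  ext1 x
  simp [impulse_one]

theorem filterOp_add {F F' : RatFunc ℝ} (hF : HasSummableExpansion F)
    (hF' : HasSummableExpansion F') :
    (filterOp (F + F') : (ℤ →ᵇ E) →L[ℝ] (ℤ →ᵇ E)) = filterOp F + filterOp F' := by
  simp only [filterOp, impulse_add, add_smul]
  exact (summable_smul_delay hF).tsum_add (summable_smul_delay hF')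

theorem filterOp_sub {F F' : RatFunc ℝ} (hF : HasSummableExpansion F)
    (hF' : HasSummableExpansion F') :
    (filterOp (F - F') : (ℤ →ᵇ E) →L[ℝ] (ℤ →ᵇ E)) = filterOp F - filterOp F' := by
  rw [eq_sub_iff_add_eq, ← filterOp_add (hF.sub hF') hF', sub_add_cancel]

/-- Both sides are the Cauchy product of two absolutely convergent series, because delays compose by
adding their lengths. -/
theorem filterOp_mul {F F' : RatFunc ℝ} (hF : HasSummableExpansion F)
    (hF' : HasSummableExpansion F') :
    (filterOp (F * F') : (ℤ →ᵇ E) →L[ℝ] (ℤ →ᵇ E)) = filterOp F * filterOp F' := by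
  have h := tsum_mul_tsum_eq_tsum_sum_antidiagonal_of_summable_norm
    (summable_norm_smul_delay (E := E) hF) (summable_norm_smul_delay (E := E) hF')
  refine Eq.trans ?_ h.symm
  refine tsum_congr fun k => ?_
  rw [hF.impulse_mul hF', Finset.sum_smul]
  refine Finset.sum_congr rfl fun ij hij => ?_
  rw [smul_mul_smul_comm, delay_mul, ← Nat.cast_add, Finset.HasAntidiagonal.mem_antidiagonal.1 hij]

theorem filterOp_sum {ι : Type*} (s : Finset ι) {F : ι → RatFunc ℝ}
    (hF : ∀ i, HasSummableExpansion (F i)) :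
    (filterOp (∑ i ∈ s, F i) : (ℤ →ᵇ E) →L[ℝ] (ℤ →ᵇ E)) = ∑ i ∈ s, filterOp (F i) := by
  classical
  induction s using Finset.induction_on with
  | empty => simp [filterOp_zero]
  | insert i s hi ih =>
    rw [Finset.sum_insert hi, Finset.sum_insert hi,
      filterOp_add (hF i) (HasSummableExpansion.sum fun i _ => hF i), ih]

section Mat

variable {α β γ : Type*} [Fintype β] [Fintype γ]

theorem filterMat_mul {F : Matrix α β (RatFunc ℝ)} {F' : Matrix β γ (RatFunc ℝ)}
    (hF : ∀ a b, HasSummableExpansion (F a b)) (hF' : ∀ a b, HasSummableExpansion (F' a b))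
    (s : γ → ℤ →ᵇ E) : filterMat (F * F') s = filterMat F (filterMat F' s) := by
  funext a
  simp only [filterMat, Matrix.mul_apply, map_sum]
  rw [Finset.sum_comm]
  refine Finset.sum_congr rfl fun c _ => ?_
  rw [filterOp_sum _ fun b => (hF a b).mul (hF' b c), sum_apply]
  refine Finset.sum_congr rfl fun b _ => ?_
  rw [filterOp_mul (hF a b) (hF' b c)]
  rfl

theorem filterMat_sub {F F' : Matrix α β (RatFunc ℝ)}
    (hF : ∀ a b, HasSummableExpansion (F a b)) (hF' : ∀ a b, HasSummableExpansion (F' a b))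
    (s : β → ℤ →ᵇ E) : filterMat (F - F') s = filterMat F s - filterMat F' s := by
  funext a
  simp only [filterMat, Matrix.sub_apply, Pi.sub_apply, ← Finset.sum_sub_distrib]
  refine Finset.sum_congr rfl fun b _ => ?_
  rw [filterOp_sub (hF a b) (hF' a b)]
  rfl

omit [CompleteSpace E] in
theorem filterMat_one [DecidableEq β] (s : β → ℤ →ᵇ E) :
    filterMat (1 : Matrix β β (RatFunc ℝ)) s = s := by
  funext a
  rw [filterMat, Finset.sum_eq_single a]
  · simp [filterOp_one]
  · intro b _ hb
    simp [Matrix.one_apply_ne hb.symm, filterOp_zero]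
  · simp

omit [CompleteSpace E] in
theorem filterMat_add_right (F : Matrix α β (RatFunc ℝ)) (s s' : β → ℤ →ᵇ E) :
    filterMat F (s + s') = filterMat F s + filterMat F s' := by
  funext a
  simp [filterMat, Finset.sum_add_distrib]

omit [CompleteSpace E] in
theorem filterMat_sub_right (F : Matrix α β (RatFunc ℝ)) (s s' : β → ℤ →ᵇ E) :
    filterMat F (s - s') = filterMat F s - filterMat F s' := by
  funext a
  simp [filterMat]

omit [CompleteSpace E] in
theorem filterMat_fromCols (F : Matrix α β (RatFunc ℝ)) (F' : Matrix α γ (RatFunc ℝ))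
    (s : β ⊕ γ → ℤ →ᵇ E) :
    filterMat (Matrix.fromCols F F') s =
      filterMat F (fun b => s (Sum.inl b)) + filterMat F' (fun c => s (Sum.inr c)) := by
  funext a
  simp [filterMat]

end Mat

end Operators

/-! ### Time averages of inner products -/

section Averages

variable [InnerProductSpace ℝ E]

/-- The average over `1 ≤ t ≤ N` of `⟪x t, y t⟫`, as a linear form in `y`. -/
def avg (N : ℕ) (x : ℤ →ᵇ E) : (ℤ →ᵇ E) →L[ℝ] ℝ :=
  (N : ℝ)⁻¹ • ∑ t ∈ Finset.Icc 1 N,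
    (innerSL ℝ (x (t : ℤ))).comp (BoundedContinuousFunction.evalCLM ℝ (t : ℤ))

theorem avg_apply (N : ℕ) (x y : ℤ →ᵇ E) :
    avg N x y = (N : ℝ)⁻¹ * ∑ t ∈ Finset.Icc 1 N, ⟪x (t : ℤ), y (t : ℤ)⟫ := by
  simp [avg]

theorem avg_comm (N : ℕ) (x y : ℤ →ᵇ E) : avg N x y = avg N y x := by
  simp only [avg_apply, real_inner_comm]

theorem abs_inner_apply_le (x y : ℤ →ᵇ E) (t : ℤ) : |⟪x t, y t⟫| ≤ ‖x‖ * ‖y‖ :=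
  (abs_real_inner_le_norm _ _).trans
    (mul_le_mul (x.norm_coe_le_norm t) (y.norm_coe_le_norm t) (norm_nonneg _) (norm_nonneg _))

theorem abs_avg_le (N : ℕ) (x y : ℤ →ᵇ E) : |avg N x y| ≤ ‖x‖ * ‖y‖ := by
  rw [avg_apply, abs_mul, abs_of_nonneg (by positivity : (0 : ℝ) ≤ (N : ℝ)⁻¹)]
  have h : |∑ t ∈ Finset.Icc 1 N, ⟪x (t : ℤ), y (t : ℤ)⟫| ≤ N * (‖x‖ * ‖y‖) := by
    refine (Finset.abs_sum_le_sum_abs _ _).trans ?_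
    refine (Finset.sum_le_sum fun (t : ℕ) _ => abs_inner_apply_le x y t).trans ?_
    simp
  rcases Nat.eq_zero_or_pos N with rfl | hN
  · simp only [Nat.cast_zero, inv_zero, zero_mul]
    positivity
  · have hN' : (0 : ℝ) < N := Nat.cast_pos.2 hN
    rw [inv_mul_le_iff₀ hN']
    exact h

theorem avg_self_nonneg (N : ℕ) (x : ℤ →ᵇ E) : 0 ≤ avg N x x := by
  rw [avg_apply]
  exact mul_nonneg (by positivity) (Finset.sum_nonneg fun t _ => real_inner_self_nonneg)

theorem avg_sq_le (N : ℕ) (x y : ℤ →ᵇ E) : avg N x y ^ 2 ≤ avg N x x * avg N y y := by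
  have h : ∀ r : ℝ, 0 ≤ avg N y y * (r * r) + 2 * avg N x y * r + avg N x x := by
    intro r
    have h1 := avg_self_nonneg N (x + r • y)
    rw [map_add, map_smul, avg_comm N (x + r • y) x, avg_comm N (x + r • y) y, map_add, map_add,
      map_smul, map_smul, avg_comm N y x, smul_eq_mul, smul_eq_mul, smul_eq_mul] at h1
    linarith
  have hd := discrim_le_zero h
  rw [discrim] at hd
  nlinarith

/-- The two sums telescope to a pair of bounded boundary terms, which division by `N` kills. -/
theorem tendsto_avg_delay_one_sub (x y : ℤ →ᵇ E) :
    Tendsto (fun N => avg N (delay 1 x) (delay 1 y) - avg N x y) atTop (𝓝 0) := by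
  have htel : ∀ N : ℕ, ∑ t ∈ Finset.Icc 1 N, ⟪x ((t : ℤ) - 1), y ((t : ℤ) - 1)⟫ -
      ∑ t ∈ Finset.Icc 1 N, ⟪x (t : ℤ), y (t : ℤ)⟫ = ⟪x 0, y 0⟫ - ⟪x (N : ℤ), y (N : ℤ)⟫ := by
    intro N
    induction N with
    | zero => simp
    | succ N ih =>
      rw [Finset.sum_Icc_succ_top (by omega), Finset.sum_Icc_succ_top (by omega)]
      push_cast
      rw [add_sub_cancel_right]
      linarith
  refine squeeze_zero_norm (a := fun N : ℕ => (N : ℝ)⁻¹ * (2 * (‖x‖ * ‖y‖))) (fun N => ?_) ?_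
  · rw [avg_apply, avg_apply, ← mul_sub]
    simp only [delay_apply]
    rw [htel, Real.norm_eq_abs, abs_mul, abs_of_nonneg (by positivity : (0 : ℝ) ≤ (N : ℝ)⁻¹)]
    refine mul_le_mul_of_nonneg_left ?_ (by positivity)
    refine (abs_sub _ _).trans ?_
    linarith [abs_inner_apply_le x y 0, abs_inner_apply_le x y N]
  · simpa using (tendsto_inv_atTop_nhds_zero_nat (𝕜 := ℝ)).mul_const (2 * (‖x‖ * ‖y‖))

theorem tendsto_avg_delay_sub (k : ℤ) : ∀ x y : ℤ →ᵇ E,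
    Tendsto (fun N => avg N (delay k x) (delay k y) - avg N x y) atTop (𝓝 0) := by
  induction k using Int.induction_on with
  | zero => simp
  | succ k ih =>
    intro x y
    have h := (tendsto_avg_delay_one_sub (delay k x) (delay k y)).add (ih x y)
    simpa [delay_delay, add_comm (1 : ℤ)] using h
  | pred k ih =>
    intro x y
    have h := (ih x y).sub (tendsto_avg_delay_one_sub (delay (-k - 1) x) (delay (-k - 1) y))
    simpa [delay_delay] using h

theorem tendsto_avg_delay {x y : ℤ →ᵇ E} {L : ℝ} (k : ℤ)
    (h : Tendsto (fun N => avg N x y) atTop (𝓝 L)) :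
    Tendsto (fun N => avg N (delay k x) (delay k y)) atTop (𝓝 L) := by
  simpa using (tendsto_avg_delay_sub k x y).add h

theorem avg_filterOp [CompleteSpace E] {F : RatFunc ℝ} (hF : HasSummableExpansion F) (N : ℕ)
    (x y : ℤ →ᵇ E) :
    avg N x (filterOp F y) = ∑' k : ℕ, impulse F k * avg N x (delay k y) := by
  rw [← ((filterOp_hasSum hF y).mapL (avg N x)).tsum_eq]
  simp

theorem tendsto_avg_filterOp [CompleteSpace E] {F : RatFunc ℝ} (hF : HasSummableExpansion F)
    {x y : ℤ →ᵇ E} {r : ℕ → ℝ}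
    (h : ∀ k : ℕ, Tendsto (fun N => avg N x (delay k y)) atTop (𝓝 (r k))) :
    Tendsto (fun N => avg N x (filterOp F y)) atTop (𝓝 (∑' k, impulse F k * r k)) := by
  simp only [avg_filterOp hF]
  -- The averages are bounded by `‖x‖ * ‖y‖` uniformly in `N` and in the delay.
  refine tendsto_tsum_of_dominated_convergence (hF.summable.mul_right (‖x‖ * ‖y‖))
    (fun k => (h k).const_mul _) (Eventually.of_forall fun N k => ?_)
  rw [norm_mul]
  refine mul_le_mul_of_nonneg_left ?_ (norm_nonneg _)
  refine (abs_avg_le _ _ _).trans (mul_le_mul_of_nonneg_left ?_ (norm_nonneg _))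
  exact norm_delay_apply_le _ y

theorem tendsto_avg_filterOp_filterOp [CompleteSpace E] {F F' : RatFunc ℝ}
    (hF : HasSummableExpansion F) (hF' : HasSummableExpansion F') {x y : ℤ →ᵇ E} {R : ℤ → ℝ}
    (h : ∀ τ : ℤ, Tendsto (fun N => avg N x (delay τ y)) atTop (𝓝 (R τ))) :
    Tendsto (fun N => avg N (filterOp F x) (filterOp F' y)) atTop
      (𝓝 (∑' l : ℕ, impulse F' l * ∑' k : ℕ, impulse F k * R (l - k))) := by
  refine tendsto_avg_filterOp hF' fun l => ?_
  simp only [avg_comm _ (filterOp F x)]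
  refine tendsto_avg_filterOp hF fun k => ?_
  simp only [avg_comm _ (delay (l : ℤ) y)]
  -- A common delay by `k` does not change the limit, so delays `k` and `l` matter only through `l -
  -- k`.
  simpa [delay_delay] using tendsto_avg_delay (k : ℤ) (h (l - k))

/-- Sequences that are asymptotically negligible in quadratic mean. -/
def IsNegligible (x : ℤ →ᵇ E) : Prop :=
  ∀ z : ℤ →ᵇ E, Tendsto (fun N => avg N x z) atTop (𝓝 0)

/-- Cauchy–Schwarz. Testing against all bounded sequences makes negligibility a linear condition,
and a delay of `x` can be undone by the opposite delay of the test sequence; hence the stability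
under filters below. -/
theorem isNegligible_of_tendsto_avg_self {x : ℤ →ᵇ E}
    (h : Tendsto (fun N => avg N x x) atTop (𝓝 0)) : IsNegligible x := by
  intro z
  have hsq : Tendsto (fun N => avg N x z ^ 2) atTop (𝓝 0) := by
    refine squeeze_zero (fun N => sq_nonneg _) (fun N => ?_)
      (by simpa using h.mul_const (‖z‖ * ‖z‖))
    refine (avg_sq_le N x z).trans (mul_le_mul_of_nonneg_left ?_ (avg_self_nonneg N x))
    exact (le_abs_self _).trans (abs_avg_le N z z)
  have h2 := (Real.continuous_sqrt.tendsto 0).comp hsq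
  simp only [Real.sqrt_zero, Function.comp_def, Real.sqrt_sq_eq_abs] at h2
  exact (tendsto_zero_iff_abs_tendsto_zero _).2 h2

namespace IsNegligible

theorem smul {x : ℤ →ᵇ E} (hx : IsNegligible x) (c : ℝ) : IsNegligible (c • x) := by
  intro z
  simp only [avg_comm _ _ z, map_smul, smul_eq_mul]
  simpa [avg_comm _ z] using (hx z).const_mul c

theorem sum {ι : Type*} {s : Finset ι} {x : ι → ℤ →ᵇ E} (hx : ∀ i ∈ s, IsNegligible (x i)) :
    IsNegligible (∑ i ∈ s, x i) := by
  intro z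
  simp only [avg_comm _ _ z, map_sum]
  simpa [avg_comm _ z] using tendsto_finsetSum s fun i hi => hx i hi z

theorem filterOp [CompleteSpace E] {x : ℤ →ᵇ E} (hx : IsNegligible x) {F : RatFunc ℝ}
    (hF : HasSummableExpansion F) : IsNegligible (filterOp F x) := by
  intro z
  have h := tendsto_avg_filterOp (x := z) (y := x) (r := fun _ => 0) hF fun k => by
    simp only [avg_comm _ z]
    simpa [delay_delay] using tendsto_avg_delay (k : ℤ) (hx (delay (-k) z))
  simpa [avg_comm _ z] using h

theorem filterMat [CompleteSpace E] {α β : Type*} [Fintype β] {x : β → ℤ →ᵇ E}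
    (hx : ∀ b, IsNegligible (x b)) {F : Matrix α β (RatFunc ℝ)}
    (hF : ∀ a b, HasSummableExpansion (F a b)) (a : α) : IsNegligible (filterMat F x a) :=
  sum fun b _ => (hx b).filterOp (hF a b)

end IsNegligible

end Averages

/-! ### Frequency responses -/

/-- The complex conjugate of the frequency response of `F`: the value of `F` at `exp (-iw)`. -/
def freqResponse (F : RatFunc ℝ) (w : ℝ) : ℂ :=
  ∑' k : ℕ, (impulse F k : ℂ) * Complex.exp (Complex.I * w * k)

theorem norm_exp_I_mul (w : ℝ) (k : ℤ) : ‖Complex.exp (Complex.I * w * k)‖ = 1 := by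
  have h : Complex.I * w * k = ((w * k : ℝ) : ℂ) * Complex.I := by push_cast; ring
  rw [h, Complex.norm_exp_ofReal_mul_I]

theorem conj_exp_I_mul (w : ℝ) (k : ℤ) :
    (starRingEnd ℂ) (Complex.exp (Complex.I * w * k)) =
      Complex.exp (Complex.I * w * (-k : ℤ)) := by
  rw [← Complex.exp_conj]
  simp

theorem hasSum_mul_integral {μ : Measure ℝ} {φ : ℝ → ℂ} (hφ : Integrable φ μ) {g : ℕ → ℝ}
    (hg : Summable fun k => ‖g k‖) {e : ℕ → ℝ → ℂ} (he : ∀ k, Continuous (e k))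
    (he1 : ∀ k w, ‖e k w‖ = 1) :
    HasSum (fun k => (g k : ℂ) * ∫ w, φ w * e k w ∂μ)
      (∫ w, φ w * ∑' k, (g k : ℂ) * e k w ∂μ) := by
  have hint : ∀ k, Integrable (fun w => φ w * ((g k : ℂ) * e k w)) μ := fun k =>
    hφ.mul_bdd (c := ‖g k‖) (continuous_const.mul (he k)).aestronglyMeasurable
      (Eventually.of_forall fun w => by simp [he1])
  have h := hasSum_integral_of_summable_integral_norm hint (by
    have : ∀ k, ∫ w, ‖φ w * ((g k : ℂ) * e k w)‖ ∂μ = ‖g k‖ * ∫ w, ‖φ w‖ ∂μ := by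
      intro k
      rw [← integral_const_mul]
      refine integral_congr_ae (Eventually.of_forall fun w => ?_)
      simp [he1, mul_comm]
    simpa only [this] using hg.mul_right _)
  have hl : (fun k => (g k : ℂ) * ∫ w, φ w * e k w ∂μ) =
      fun k => ∫ w, φ w * ((g k : ℂ) * e k w) ∂μ := by
    funext k
    rw [← integral_const_mul]
    refine integral_congr_ae (Eventually.of_forall fun w => ?_)
    simp only
    ring
  rw [hl]
  simpa only [tsum_mul_left] using h

variable {F F' : RatFunc ℝ}

theorem continuous_freqResponse (hF : HasSummableExpansion F) : Continuous (freqResponse F) := by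
  refine continuous_tsum (fun k => by fun_prop) hF.summable fun k w => ?_
  have := norm_exp_I_mul w k
  simp only [Int.cast_natCast] at this
  simp [this]

theorem norm_freqResponse_le (hF : HasSummableExpansion F) (w : ℝ) :
    ‖freqResponse F w‖ ≤ ∑' k, ‖impulse F k‖ := by
  refine tsum_of_norm_bounded hF.summable.hasSum fun k => ?_
  have := norm_exp_I_mul w k
  simp only [Int.cast_natCast] at this
  simp [this]

theorem conj_freqResponse (w : ℝ) :
    (starRingEnd ℂ) (freqResponse F w) =
      ∑' k : ℕ, (impulse F k : ℂ) * Complex.exp (Complex.I * w * (-k : ℤ)) := by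
  rw [freqResponse, Complex.conj_tsum]
  refine tsum_congr fun k => ?_
  rw [map_mul, Complex.conj_ofReal, ← conj_exp_I_mul]
  simp

theorem integrable_freqResponse {μ : Measure ℝ} {φ : ℝ → ℂ} (hφ : Integrable φ μ)
    (hF : HasSummableExpansion F) (hF' : HasSummableExpansion F') :
    Integrable (fun w => φ w * (starRingEnd ℂ) (freqResponse F w) * freqResponse F' w) μ := by
  refine (hφ.mul_bdd (c := ∑' k, ‖impulse F k‖) ?_ ?_).mul_bdd
    (c := ∑' k, ‖impulse F' k‖) (continuous_freqResponse hF').aestronglyMeasurable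
    (Eventually.of_forall (norm_freqResponse_le hF'))
  · exact (Complex.continuous_conj.comp (continuous_freqResponse hF)).aestronglyMeasurable
  · exact Eventually.of_forall fun w => by simpa using norm_freqResponse_le hF w

/-- The exponential of `R (l - k)` factors into one in `l` and one in `-k`. Summing the former
against `F'` gives its frequency response, the latter against `F` a conjugate one; absolute
summability permits both interchanges with the integral. -/
theorem tsum_tsum_eq_integral {μ : Measure ℝ} {φ : ℝ → ℂ} (hφ : Integrable φ μ)
    (hF : HasSummableExpansion F) (hF' : HasSummableExpansion F') {R : ℤ → ℝ} {c : ℂ}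
    (hR : ∀ τ : ℤ, (R τ : ℂ) = c * ∫ w, φ w * Complex.exp (Complex.I * w * τ) ∂μ) :
    ((∑' l : ℕ, impulse F' l * ∑' k : ℕ, impulse F k * R (l - k) : ℝ) : ℂ) =
      c * ∫ w, φ w * (starRingEnd ℂ) (freqResponse F w) * freqResponse F' w ∂μ := by
  have hin : ∀ l : ℕ, ((∑' k : ℕ, impulse F k * R (l - k) : ℝ) : ℂ) =
      c * ∫ w, φ w * (starRingEnd ℂ) (freqResponse F w) * Complex.exp (Complex.I * w * l) ∂μ := by
    intro l
    have hφl : Integrable (fun w => φ w * Complex.exp (Complex.I * w * l)) μ :=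
      hφ.mul_bdd (c := 1) (by fun_prop) (Eventually.of_forall fun w => by
        simpa using (norm_exp_I_mul w l).le)
    have h := hasSum_mul_integral hφl hF.summable
      (e := fun k w => Complex.exp (Complex.I * w * (-k : ℤ))) (fun k => by fun_prop)
      (fun k w => norm_exp_I_mul w _)
    rw [Complex.ofReal_tsum]
    simp only [conj_freqResponse]
    have h2 : (fun w => φ w * (∑' k : ℕ, (impulse F k : ℂ) *
        Complex.exp (Complex.I * w * (-k : ℤ))) * Complex.exp (Complex.I * w * l)) =
        fun w => φ w * Complex.exp (Complex.I * w * l) * ∑' k : ℕ, (impulse F k : ℂ) *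
          Complex.exp (Complex.I * w * (-k : ℤ)) := by
      funext w
      ring
    rw [h2, ← h.tsum_eq, ← tsum_mul_left]
    refine tsum_congr fun k => ?_
    rw [Complex.ofReal_mul, hR, mul_left_comm]
    congr 3
    funext w
    rw [mul_assoc (φ w), ← Complex.exp_add]
    congr 2
    push_cast
    ring
  have hφF : Integrable (fun w => φ w * (starRingEnd ℂ) (freqResponse F w)) μ :=
    hφ.mul_bdd (c := ∑' k, ‖impulse F k‖)
      (Complex.continuous_conj.comp (continuous_freqResponse hF)).aestronglyMeasurable
      (Eventually.of_forall fun w => by simpa using norm_freqResponse_le hF w)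
  have h := hasSum_mul_integral hφF hF'.summable
      (e := fun k w => Complex.exp (Complex.I * w * k)) (fun k => by fun_prop)
      (fun k w => by simpa using norm_exp_I_mul w k)
  rw [Complex.ofReal_tsum]
  change _ = c * ∫ w, φ w * (starRingEnd ℂ) (freqResponse F w) *
    (∑' k : ℕ, (impulse F' k : ℂ) * Complex.exp (Complex.I * w * k)) ∂μ
  rw [← h.tsum_eq, ← tsum_mul_left]
  refine tsum_congr fun l => ?_
  rw [Complex.ofReal_mul, hin, mul_left_comm]

theorem integral_exp_I_mul (n : ℤ) :
    ∫ w in Set.Ioc (-Real.pi) Real.pi, Complex.exp (Complex.I * w * n) =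
      if n = 0 then 2 * (Real.pi : ℂ) else 0 := by
  rw [← intervalIntegral.integral_of_le (by linarith [Real.pi_pos])]
  split_ifs with hn
  · subst hn
    simp
    ring
  · have hc : Complex.I * n ≠ 0 := mul_ne_zero Complex.I_ne_zero (Int.cast_ne_zero.2 hn)
    have h1 : ∀ w : ℝ, Complex.I * w * n = Complex.I * n * w := fun w => by ring
    simp only [h1]
    rw [integral_exp_mul_complex hc]
    have h2 : Complex.I * n * (Real.pi : ℝ) =
        Complex.I * n * ((-Real.pi : ℝ) : ℂ) + n * (2 * Real.pi * Complex.I) := by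
      push_cast
      ring
    rw [h2, Complex.exp_periodic.int_mul n, sub_self, zero_div]

/-- By orthogonality of the exponentials, `2π` times the impulse response at `k` is a Fourier
integral of the frequency response. -/
theorem eq_zero_of_freqResponse (hF : HasSummableExpansion F)
    (h0 : ∀ᵐ w ∂(volume.restrict (Set.Ioc (-Real.pi) Real.pi)), freqResponse F w = 0) : F = 0 := by
  refine hF.eq_zero_of_impulse fun k => ?_
  have hint : IntegrableOn (fun w : ℝ => Complex.exp (Complex.I * w * (-k : ℤ)))
      (Set.Ioc (-Real.pi) Real.pi) :=
    (Continuous.integrableOn_Icc (by fun_prop)).mono_set Set.Ioc_subset_Icc_self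
  have h := hasSum_mul_integral hint hF.summable
      (e := fun l w => Complex.exp (Complex.I * w * l)) (fun l => by fun_prop)
      (fun l w => by simpa using norm_exp_I_mul w l)
  have hz : ∫ w in Set.Ioc (-Real.pi) Real.pi, Complex.exp (Complex.I * w * (-k : ℤ)) *
      ∑' l : ℕ, (impulse F l : ℂ) * Complex.exp (Complex.I * w * l) = 0 := by
    refine integral_eq_zero_of_ae ?_
    filter_upwards [h0] with w hw
    rw [freqResponse] at hw
    simp [hw]
  have hl : ∀ l : ℕ, ∫ w in Set.Ioc (-Real.pi) Real.pi,
      Complex.exp (Complex.I * w * (-k : ℤ)) * Complex.exp (Complex.I * w * l) =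
        if l = k then 2 * (Real.pi : ℂ) else 0 := by
    intro l
    have h2 : ∀ w : ℝ, Complex.exp (Complex.I * w * (-k : ℤ)) * Complex.exp (Complex.I * w * l) =
        Complex.exp (Complex.I * w * ((l : ℤ) - k : ℤ)) := by
      intro w
      rw [← Complex.exp_add]
      congr 1
      push_cast
      ring
    simp only [h2, integral_exp_I_mul, sub_eq_zero, Nat.cast_inj]
  rw [hz] at h
  simp only [hl] at h
  have h3 := h.unique (hasSum_single k fun l hl => by simp [hl])
  simpa [Real.pi_ne_zero] using h3.symm

theorem ae_eq_zero_of_integral_posDef {ι : Type*} [Fintype ι] {μ : Measure ℝ}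
    {Φ : ℝ → Matrix ι ι ℂ} (hpos : ∀ᵐ w ∂μ, (Φ w).PosDef) {x : ℝ → ι → ℂ}
    (hint : Integrable (fun w => star (x w) ⬝ᵥ (Φ w).mulVec (x w)) μ)
    (h0 : ∫ w, star (x w) ⬝ᵥ (Φ w).mulVec (x w) ∂μ = 0) : ∀ᵐ w ∂μ, x w = 0 := by
  have hre : ∫ w, (star (x w) ⬝ᵥ (Φ w).mulVec (x w)).re ∂μ = 0 := by
    have := congrArg Complex.re h0
    rw [Complex.zero_re] at this
    exact (integral_re hint).trans this
  have hnn : 0 ≤ᵐ[μ] fun w => (star (x w) ⬝ᵥ (Φ w).mulVec (x w)).re := by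
    filter_upwards [hpos] with w hw
    exact hw.posSemidef.re_dotProduct_nonneg (x w)
  filter_upwards [hpos, (integral_eq_zero_iff_of_nonneg_ae hnn hint.re).1 hre] with w hw hw0
  by_contra hx
  have := (Complex.lt_def.1 (hw.dotProduct_mulVec_pos hx)).1
  simp only [Pi.zero_apply] at hw0
  simp [hw0] at this

/-! ### Averages of vector sequences and weighted quadratic forms -/

section Averages

variable {E : Type*} [NormedAddCommGroup E] [InnerProductSpace ℝ E]

theorem avg_sum_sum {ι ι' : Type*} (N : ℕ) (s : Finset ι) (s' : Finset ι') (x : ι → ℤ →ᵇ E)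
    (y : ι' → ℤ →ᵇ E) :
    avg N (∑ i ∈ s, x i) (∑ i ∈ s', y i) = ∑ i ∈ s, ∑ i' ∈ s', avg N (x i) (y i') := by
  rw [avg_comm, map_sum]
  refine Finset.sum_congr rfl fun i _ => ?_
  rw [avg_comm, map_sum]

theorem tendsto_avg_sum_filterOp [CompleteSpace E] {ι : Type*} [Fintype ι] {F F' : ι → RatFunc ℝ}
    (hF : ∀ c, HasSummableExpansion (F c)) (hF' : ∀ c, HasSummableExpansion (F' c))
    {x : ι → ℤ →ᵇ E} {R : ℤ → Matrix ι ι ℝ}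
    (h : ∀ τ c c', Tendsto (fun N => avg N (x c) (delay τ (x c'))) atTop (𝓝 (R τ c c'))) :
    Tendsto (fun N => avg N (∑ c, filterOp (F c) (x c)) (∑ c, filterOp (F' c) (x c))) atTop
      (𝓝 (∑ c, ∑ c', ∑' l : ℕ, impulse (F' c') l * ∑' k : ℕ,
        impulse (F c) k * R (l - k) c c')) := by
  simp only [avg_sum_sum]
  exact tendsto_finsetSum _ fun c _ => tendsto_finsetSum _ fun c' _ =>
    tendsto_avg_filterOp_filterOp (hF c) (hF' c') fun τ => h τ c c'

variable {ι : Type*} [Fintype ι]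

open scoped MatrixOrder in
theorem exists_isUnit_eq_transpose_mul_self [DecidableEq ι] {Q : Matrix ι ι ℝ} (hQ : Q.PosDef) :
    ∃ C : Matrix ι ι ℝ, IsUnit C ∧ Q = C.transpose * C := by
  obtain ⟨C, hC, rfl⟩ := CStarAlgebra.isStrictlyPositive_iff_eq_star_mul_self.mp
    hQ.isStrictlyPositive
  refine ⟨C, hC, ?_⟩
  rw [Matrix.star_eq_conjTranspose, Matrix.conjTranspose_eq_transpose_of_trivial]

theorem sum_transpose_mul_self_avg (C : Matrix ι ι ℝ) (N : ℕ) (x : ι → ℤ →ᵇ E) :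
    ∑ a, ∑ b, (C.transpose * C) a b * avg N (x a) (x b) =
      ∑ k, avg N (∑ a, C k a • x a) (∑ a, C k a • x a) := by
  have hsmul : ∀ k a b, avg N (C k a • x a) (C k b • x b) =
      C k a * C k b * avg N (x a) (x b) := by
    intro k a b
    rw [map_smul, avg_comm, map_smul, avg_comm, smul_eq_mul, smul_eq_mul]
    ring
  simp only [avg_sum_sum, hsmul, Matrix.mul_apply, Matrix.transpose_apply, Finset.sum_mul]
  exact (Finset.sum_congr rfl fun a _ => Finset.sum_comm).trans Finset.sum_comm

theorem sum_posDef_avg_nonneg {Q : Matrix ι ι ℝ} (hQ : Q.PosDef) (N : ℕ) (x : ι → ℤ →ᵇ E) :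
    0 ≤ ∑ a, ∑ b, Q a b * avg N (x a) (x b) := by
  classical
  obtain ⟨C, -, rfl⟩ := exists_isUnit_eq_transpose_mul_self hQ
  rw [sum_transpose_mul_self_avg]
  exact Finset.sum_nonneg fun k _ => avg_self_nonneg N _

theorem isNegligible_of_tendsto_sum_posDef {Q : Matrix ι ι ℝ} (hQ : Q.PosDef) {x : ι → ℤ →ᵇ E}
    (h : Tendsto (fun N => ∑ a, ∑ b, Q a b * avg N (x a) (x b)) atTop (𝓝 0)) (a : ι) :
    IsNegligible (x a) := by
  classical
  obtain ⟨C, hC, rfl⟩ := exists_isUnit_eq_transpose_mul_self hQ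
  simp only [sum_transpose_mul_self_avg] at h
  have hneg : ∀ k, IsNegligible (∑ b, C k b • x b) := fun k =>
    isNegligible_of_tendsto_avg_self <| squeeze_zero (fun N => avg_self_nonneg N _)
      (fun N => Finset.single_le_sum (f := fun k => avg N (∑ b, C k b • x b) (∑ b, C k b • x b))
        (fun k _ => avg_self_nonneg N _) (Finset.mem_univ k)) h
  -- With `Q = CᵀC` the weighted power is the total power of `C x`, so `C x` is negligible and `x =
  -- C⁻¹ (C x)` inherits this.
  have hx : x a = ∑ k, C⁻¹ a k • ∑ b, C k b • x b := by
    simp only [Finset.smul_sum, smul_smul]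
    rw [Finset.sum_comm]
    simp only [← Finset.sum_smul, ← Matrix.mul_apply,
      Matrix.nonsing_inv_mul C ((Matrix.isUnit_iff_isUnit_det C).1 hC)]
    simp [Matrix.one_apply, ite_smul]
  rw [hx]
  exact IsNegligible.sum fun k _ => (hneg k).smul _

end Averages

/-! ### Random signals as sequences in `L²` -/

section Signals

variable {Ω : Type*} [MeasurableSpace Ω] {P : Measure Ω}

theorem inner_eq_integral {x y : Ω → ℝ} {X Y : Lp ℝ 2 P} (hx : x =ᵐ[P] X) (hy : y =ᵐ[P] Y) :
    ⟪X, Y⟫ = ∫ ω, x ω * y ω ∂P := by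
  rw [L2.inner_def]
  refine integral_congr_ae ?_
  filter_upwards [hx, hy] with ω h1 h2
  rw [h1, h2, mul_comm]
  rfl

theorem integrable_mul_of_ae_eq {x y : Ω → ℝ} {X Y : Lp ℝ 2 P} (hx : x =ᵐ[P] X)
    (hy : y =ᵐ[P] Y) : Integrable (fun ω => x ω * y ω) P := by
  refine (L2.integrable_inner (𝕜 := ℝ) X Y).congr ?_
  filter_upwards [hx, hy] with ω h1 h2
  rw [h1, h2, mul_comm]
  rfl

/-- Products of square-integrable functions are integrable, so only the limit has content. -/
theorem hasGenExp_mul_iff {x y : ℤ → Ω → ℝ} {X Y : ℤ →ᵇ Lp ℝ 2 P} (hx : ∀ t, x t =ᵐ[P] X t)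
    (hy : ∀ t, y t =ᵐ[P] Y t) {L : ℝ} :
    HasGenExp P (fun t ω => x t ω * y t ω) L ↔ Tendsto (fun N => avg N X Y) atTop (𝓝 L) := by
  simp only [avg_apply, inner_eq_integral (hx _) (hy _)]
  exact and_iff_right fun t => integrable_mul_of_ae_eq (hx t) (hy t)

theorem HasGenExp.congr {f g : ℤ → Ω → ℝ} {L : ℝ} (hf : HasGenExp P f L)
    (h : ∀ t, g t =ᵐ[P] f t) : HasGenExp P g L := by
  refine ⟨fun t => (hf.1 t).congr (h t).symm, ?_⟩
  simp only [integral_congr_ae (h _)]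
  exact hf.2

theorem HasGenExp.const_mul {f : ℤ → Ω → ℝ} {L : ℝ} (hf : HasGenExp P f L) (c : ℝ) :
    HasGenExp P (fun t ω => c * f t ω) (c * L) := by
  refine ⟨fun t => (hf.1 t).const_mul c, ?_⟩
  simp only [integral_const_mul, ← Finset.mul_sum, mul_left_comm _ c]
  exact hf.2.const_mul c

theorem HasGenExp.sum {ι : Type*} {s : Finset ι} {f : ι → ℤ → Ω → ℝ} {L : ι → ℝ}
    (hf : ∀ i ∈ s, HasGenExp P (f i) (L i)) :
    HasGenExp P (fun t ω => ∑ i ∈ s, f i t ω) (∑ i ∈ s, L i) := by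
  refine ⟨fun t => integrable_finsetSum s fun i hi => (hf i hi).1 t, ?_⟩
  have h : ∀ t : ℤ, ∫ ω, ∑ i ∈ s, f i t ω ∂P = ∑ i ∈ s, ∫ ω, f i t ω ∂P := fun t =>
    integral_finsetSum s fun i hi => (hf i hi).1 t
  simp only [h]
  have h2 : ∀ N : ℕ, (N : ℝ)⁻¹ * ∑ t ∈ Finset.Icc 1 N, ∑ i ∈ s, ∫ ω, f i (t : ℤ) ω ∂P =
      ∑ i ∈ s, (N : ℝ)⁻¹ * ∑ t ∈ Finset.Icc 1 N, ∫ ω, f i (t : ℤ) ω ∂P := by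
    intro N
    rw [Finset.sum_comm, Finset.mul_sum]
  simp only [h2]
  exact tendsto_finsetSum s fun i hi => (hf i hi).2

theorem exists_ae_eq_boundedContinuousFunction {x : ℤ → Ω → ℝ} (hx : ∀ t, MemLp (x t) 2 P) {C : ℝ}
    (hC : ∀ t, ∫ ω, x t ω ^ 2 ∂P ≤ C) : ∃ X : ℤ →ᵇ Lp ℝ 2 P, ∀ t, x t =ᵐ[P] X t := by
  refine ⟨BoundedContinuousFunction.ofNormedAddCommGroupDiscrete (fun t => (hx t).toLp)
    (Real.sqrt C) fun t => ?_, fun t => (MemLp.coeFn_toLp (hx t)).symm⟩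
  refine Real.le_sqrt_of_sq_le ?_
  rw [← real_inner_self_eq_norm_sq, inner_eq_integral (MemLp.coeFn_toLp (hx t)).symm
    (MemLp.coeFn_toLp (hx t)).symm]
  simpa only [sq] using hC t

theorem IsQuasiStationary.exists_ae_eq {ι : Type*} {s : ℤ → Ω → ι → ℝ}
    (hs : IsQuasiStationary P s) :
    ∃ S : ι → ℤ →ᵇ Lp ℝ 2 P, ∀ c t, (fun ω => s t ω c) =ᵐ[P] S c t := by
  obtain ⟨C, hC⟩ := hs.bounded
  choose S hS using fun c => exists_ae_eq_boundedContinuousFunction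
    (x := fun t ω => s t ω c) (fun t => hs.memLp t c) (fun t => hC t c)
  exact ⟨S, hS⟩

theorem HasCovariance.tendsto_avg {ι : Type*} {s : ℤ → Ω → ι → ℝ} {R : ℤ → Matrix ι ι ℝ}
    (hR : HasCovariance P s R) {S : ι → ℤ →ᵇ Lp ℝ 2 P}
    (hS : ∀ c t, (fun ω => s t ω c) =ᵐ[P] S c t) (τ : ℤ) (c c' : ι) :
    Tendsto (fun N => avg N (S c) (delay τ (S c'))) atTop (𝓝 (R τ c c')) :=
  (hasGenExp_mul_iff (x := fun t ω => s t ω c) (y := fun t ω => s (t - τ) ω c') (hS c)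
    fun t => hS c' (t - τ)).1 (hR τ c c')

/-- The `L²` norms of the terms are summable, so the series also converges pointwise almost
everywhere, to the same sum. This identifies pathwise filtering with `filterOp`. -/
theorem tsum_impulse_mul_ae_eq {F : RatFunc ℝ} (hF : HasSummableExpansion F) {x : ℤ → Ω → ℝ}
    {X : ℤ →ᵇ Lp ℝ 2 P} (hx : ∀ t, x t =ᵐ[P] X t) (t : ℤ) :
    (fun ω => ∑' k : ℕ, impulse F k * x (t - k) ω) =ᵐ[P] filterOp F X t := by
  rw [filterOp_apply hF]
  have hsum : Summable fun k : ℕ => ‖impulse F k • X (t - k)‖ := by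
    refine Summable.of_nonneg_of_le (fun _ => norm_nonneg _) (fun k => ?_)
      (hF.summable.mul_right ‖X‖)
    rw [norm_smul]
    exact mul_le_mul_of_nonneg_left (X.norm_coe_le_norm _) (norm_nonneg _)
  have hfin : ∑' k : ℕ, ‖impulse F k • X (t - k)‖ₑ ≠ ⊤ := by
    simpa only [ofReal_norm] using hsum.tsum_ofReal_ne_top
  have hall : ∀ᵐ ω ∂P, ∀ k : ℕ, (impulse F k • X (t - k) : Lp ℝ 2 P) ω =
      impulse F k * x (t - k) ω := by
    rw [ae_all_iff]
    intro k
    filter_upwards [Lp.coeFn_smul (impulse F k) (X (t - k)), hx (t - k)] with ω h1 h2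
    rw [h1, h2, Pi.smul_apply, smul_eq_mul]
  filter_upwards [Lp.coeFn_tsum hfin, hall] with ω h1 h2
  rw [h1]
  exact tsum_congr fun k => (h2 k).symm

theorem filt_ae_eq {α β : Type*} [Fintype β] {F : Matrix α β (RatFunc ℝ)}
    (hF : ∀ a b, HasSummableExpansion (F a b)) {s : ℤ → Ω → β → ℝ} {S : β → ℤ →ᵇ Lp ℝ 2 P}
    (hS : ∀ b t, (fun ω => s t ω b) =ᵐ[P] S b t) (a : α) (t : ℤ) :
    (fun ω => filt F s t ω a) =ᵐ[P] filterMat F S a t := by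
  have h : ∀ᵐ ω ∂P, ∀ b, ∑' k : ℕ, impulse (F a b) k * s (t - k) ω b =
      filterOp (F a b) (S b) t ω :=
    ae_all_iff.2 fun b => tsum_impulse_mul_ae_eq (hF a b) (hS b) t
  have h2 : filterMat F S a t = ∑ b, filterOp (F a b) (S b) t := by
    rw [filterMat, BoundedContinuousFunction.coe_sum, Finset.sum_apply]
  rw [h2]
  filter_upwards [h, Lp.coeFn_fun_finsetSum Finset.univ fun b => filterOp (F a b) (S b) t]
    with ω h3 h4
  rw [h4]
  exact Finset.sum_congr rfl fun b _ => h3 b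

theorem eq_zero_of_isNegligible_of_hasSpectralDensity {ι : Type*} [Fintype ι]
    {s : ℤ → Ω → ι → ℝ} {S : ι → ℤ →ᵇ Lp ℝ 2 P} (hS : ∀ c t, (fun ω => s t ω c) =ᵐ[P] S c t)
    {Φ : ℝ → Matrix ι ι ℂ} (hΦ : HasSpectralDensity P s Φ)
    (hpos : ∀ᵐ w ∂(volume.restrict (Set.Ioc (-Real.pi) Real.pi)), (Φ w).PosDef)
    {F : ι → RatFunc ℝ} (hF : ∀ c, HasSummableExpansion (F c))
    (hneg : IsNegligible (∑ c, filterOp (F c) (S c))) (c : ι) : F c = 0 := by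
  obtain ⟨hint, R, hR, hRΦ⟩ := hΦ
  -- The power of the filtered signal has two limits: its covariance expression, and zero by
  -- negligibility tested against the signal itself.
  have hlim := tendsto_nhds_unique (tendsto_avg_sum_filterOp hF hF (hR.tendsto_avg hS)) (hneg _)
  have hterm : ∀ a b, ((∑' l : ℕ, impulse (F b) l * ∑' k : ℕ,
      impulse (F a) k * R (l - k) a b : ℝ) : ℂ) = (2 * (Real.pi : ℂ))⁻¹ *
        ∫ w in Set.Ioc (-Real.pi) Real.pi,
          Φ w a b * (starRingEnd ℂ) (freqResponse (F a) w) * freqResponse (F b) w := by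
    intro a b
    refine tsum_tsum_eq_integral (R := fun τ => R τ a b) (hint a b) (hF a) (hF b) fun τ => ?_
    rw [hRΦ, intervalIntegral.integral_of_le (by linarith [Real.pi_pos])]
  have hi := fun a b => integrable_freqResponse (hint a b) (hF a) (hF b)
  have hquad : ∀ w, star (fun a => freqResponse (F a) w) ⬝ᵥ
      (Φ w).mulVec (fun a => freqResponse (F a) w) = ∑ a, ∑ b,
        Φ w a b * (starRingEnd ℂ) (freqResponse (F a) w) * freqResponse (F b) w := by
    intro w
    simp only [dotProduct, Matrix.mulVec, Pi.star_apply, Finset.mul_sum]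
    refine Finset.sum_congr rfl fun a _ => Finset.sum_congr rfl fun b _ => ?_
    rw [starRingEnd_apply]
    ring
  have hzero : ∫ w in Set.Ioc (-Real.pi) Real.pi, star (fun a => freqResponse (F a) w) ⬝ᵥ
      (Φ w).mulVec (fun a => freqResponse (F a) w) = 0 := by
    simp only [hquad]
    rw [integral_finsetSum _ fun a _ => integrable_finsetSum _ fun b _ => hi a b]
    simp only [integral_finsetSum Finset.univ fun b _ => hi _ b]
    have h := congrArg (Complex.ofReal) hlim
    simp only [Complex.ofReal_sum, hterm, ← Finset.mul_sum, Complex.ofReal_zero] at h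
    exact (mul_eq_zero.1 h).resolve_left (by simp [Real.pi_ne_zero])
  have hae := ae_eq_zero_of_integral_posDef hpos (x := fun w a => freqResponse (F a) w)
    (by
      simp only [hquad]
      exact integrable_finsetSum _ fun a _ => integrable_finsetSum _ fun b _ => hi a b) hzero
  refine eq_zero_of_freqResponse (hF c) ?_
  filter_upwards [hae] with w hw using congrFun hw c

end Signals

theorem hasGenExp_quadraticForm {Ω ι : Type*} [MeasurableSpace Ω] {P : Measure Ω} [Fintype ι]
    {x : ℤ → Ω → ι → ℝ} {X : ι → ℤ →ᵇ Lp ℝ 2 P} (hx : ∀ a t, (fun ω => x t ω a) =ᵐ[P] X a t)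
    (Q : Matrix ι ι ℝ) {L : ι → ι → ℝ}
    (hL : ∀ a b, Tendsto (fun N => avg N (X a) (X b)) atTop (𝓝 (L a b))) :
    HasGenExp P (fun t ω => x t ω ⬝ᵥ Q.mulVec (x t ω)) (∑ a, ∑ b, Q a b * L a b) := by
  have h := HasGenExp.sum (s := Finset.univ) fun a _ => HasGenExp.sum (s := Finset.univ) fun b _ =>
    ((hasGenExp_mul_iff (hx a) (hx b)).2 (hL a b)).const_mul (Q a b)
  refine h.congr fun t => Eventually.of_forall fun ω => ?_
  simp only [dotProduct, Matrix.mulVec, Finset.mul_sum]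
  exact Finset.sum_congr rfl fun a _ => Finset.sum_congr rfl fun b _ => by ring

/-! ### Decomposition of the prediction error into innovation and mismatch -/

theorem IsNoiseModel.inv_mul {p : ℕ} {H : Matrix (Fin p) (Fin p) (RatFunc ℝ)}
    (hH : IsNoiseModel H) : H⁻¹ * H = 1 :=
  Matrix.nonsing_inv_mul H hH.invertible

theorem IsNoiseModel.mul_inv {p : ℕ} {H : Matrix (Fin p) (Fin p) (RatFunc ℝ)}
    (hH : IsNoiseModel H) : H * H⁻¹ = 1 :=
  Matrix.mul_nonsing_inv H hH.invertible

section

variable {m p : ℕ} {G₀ G : Matrix (Fin p) (Fin m) (RatFunc ℝ)}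
  {H₀ H : Matrix (Fin p) (Fin p) (RatFunc ℝ)}

theorem hasSummableExpansion_fromCols (hG : IsStableMatrix G) (hH : IsStableMatrix H)
    (a : Fin p) (c : Fin m ⊕ Fin p) : HasSummableExpansion (Matrix.fromCols G H a c) := by
  cases c with
  | inl c => exact (hG a c).hasSummableExpansion
  | inr c => exact (hH a c).hasSummableExpansion

/-- The prediction error is the innovation plus the filtered model mismatch. -/
theorem predictionError_filterMat {E : Type*} [NormedAddCommGroup E] [NormedSpace ℝ E]
    [CompleteSpace E] (hG₀ : IsStableMatrix G₀) (hH₀ : IsStableMatrix H₀) (hG : IsStableMatrix G)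
    (hH : IsNoiseModel H) (K : Fin m ⊕ Fin p → ℤ →ᵇ E) :
    filterMat (Matrix.fromCols G₀ H₀) K -
      (filterMat (1 - H⁻¹) (filterMat (Matrix.fromCols G₀ H₀) K) +
        filterMat (H⁻¹ * G) (fun c => K (Sum.inl c))) =
    (fun a => K (Sum.inr a)) +
      filterMat H⁻¹ (filterMat (Matrix.fromCols G₀ H₀ - Matrix.fromCols G H) K) := by
  have h1 : ∀ a b, HasSummableExpansion ((1 : Matrix (Fin p) (Fin p) (RatFunc ℝ)) a b) := by
    intro a b
    rw [Matrix.one_apply]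
    split_ifs
    exacts [.one, .zero]
  have hHi := fun a b => (hH.stable_inv a b).hasSummableExpansion
  have hHs := fun a b => (hH.stable a b).hasSummableExpansion
  have hGs := fun a b => (hG a b).hasSummableExpansion
  -- Splitting `M κ` into `G u + H e` on the right, `H⁻¹ H = 1` gives back `e`, which cancels.
  rw [filterMat_sub h1 hHi, filterMat_one, filterMat_mul hHi hGs,
    filterMat_sub (hasSummableExpansion_fromCols hG₀ hH₀)
      (hasSummableExpansion_fromCols hG hH.stable),
    filterMat_sub_right, filterMat_fromCols G H, filterMat_add_right, ← filterMat_mul hHi hHs,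
    hH.inv_mul, filterMat_one]
  abel

/-- Both noise models equal `I` at infinity, so their difference is strictly proper and stays so
after multiplication by the proper `H⁻¹`. -/
theorem impulse_zero_mismatch (hG₀ : IsStableMatrix G₀) (hH₀ : IsNoiseModel H₀)
    (hG : IsStableMatrix G) (hH : IsNoiseModel H) (a i : Fin p) :
    impulse ((H⁻¹ * (Matrix.fromCols G₀ H₀ - Matrix.fromCols G H)) a (Sum.inr i)) 0 = 0 := by
  have hsum : ∀ (s : Finset (Fin p)) (f : Fin p → RatFunc ℝ),
      (∀ b, impulse (f b) 0 = 0) → impulse (∑ b ∈ s, f b) 0 = 0 := fun s f hf =>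
    Finset.sum_induction _ (fun g => impulse g 0 = 0)
      (fun g g' hg hg' => by rw [impulse_add, hg, hg', add_zero]) (impulse_zero 0) fun b _ => hf b
  rw [Matrix.mul_apply]
  refine hsum _ _ fun b => ?_
  rw [Matrix.sub_apply, (hH.stable_inv a b).hasSummableExpansion.impulse_mul
    ((hasSummableExpansion_fromCols hG₀ hH₀.stable b _).sub
      (hasSummableExpansion_fromCols hG hH.stable b _))]
  simp [impulse_sub, hH₀.monic.2 b i, hH.monic.2 b i]

end

section

variable {Ω : Type*} [MeasurableSpace Ω] {P : Measure Ω} {m p : ℕ}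
  {u : ℤ → Ω → Fin m → ℝ} {e : ℤ → Ω → Fin p → ℝ} {K : Fin m ⊕ Fin p → ℤ →ᵇ Lp ℝ 2 P}
  {Λ : Matrix (Fin p) (Fin p) ℝ}

theorem tendsto_avg_noise (he : IsWhiteNoise P e Λ)
    (hK : ∀ c t, (fun ω => kappa u e t ω c) =ᵐ[P] K c t) (a b : Fin p) :
    Tendsto (fun N => avg N (K (Sum.inr a)) (K (Sum.inr b))) atTop (𝓝 (Λ a b)) := by
  refine tendsto_const_nhds.congr' ?_
  -- The average is exactly `Λ a b` once `N > 0`; at `N = 0` it is zero.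
  filter_upwards [eventually_gt_atTop 0] with N hN
  have hin : ∀ t : ℤ, ⟪K (Sum.inr a) t, K (Sum.inr b) t⟫ = Λ a b := fun t =>
    (inner_eq_integral (hK (Sum.inr a) t) (hK (Sum.inr b) t)).trans (he.covariance t a b)
  have hN' : (N : ℝ) ≠ 0 := by positivity
  simp [avg_apply, hin, hN']

/-- Inputs enter at times `t - k ≤ t`, where they are uncorrelated with `e(t)`. Noise enters only
with `k ≥ 1`, where whiteness applies, so the average vanishes for every `N`. -/
theorem avg_noise_filterMat_eq_zero (he : IsWhiteNoise P e Λ)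
    (hue : ∀ s t : ℤ, s ≤ t → ∀ k i, ∫ ω, u s ω k * e t ω i ∂P = 0)
    (hK : ∀ c t, (fun ω => kappa u e t ω c) =ᵐ[P] K c t)
    {D : Matrix (Fin p) (Fin m ⊕ Fin p) (RatFunc ℝ)} (hD : ∀ a c, HasSummableExpansion (D a c))
    (hD0 : ∀ a i, impulse (D a (Sum.inr i)) 0 = 0) (N : ℕ) (a b : Fin p) :
    avg N (K (Sum.inr a)) (filterMat D K b) = 0 := by
  rw [filterMat, map_sum]
  refine Finset.sum_eq_zero fun c _ => ?_
  rw [avg_filterOp (hD b c)]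
  refine (tsum_congr fun k => ?_).trans tsum_zero
  have hin : ∀ t : ℤ, ⟪K (Sum.inr a) t, delay (k : ℤ) (K c) t⟫ =
      ∫ ω, e t ω a * kappa u e (t - k) ω c ∂P := fun t =>
    inner_eq_integral (hK (Sum.inr a) t) (hK c (t - k))
  rw [avg_apply]
  simp only [hin]
  cases c with
  | inl c =>
    have hz : ∀ t : ℤ, ∫ ω, e t ω a * kappa u e (t - k) ω (Sum.inl c) ∂P = 0 := by
      intro t
      rw [← hue (t - k) t (by omega) c a]
      exact integral_congr_ae (Eventually.of_forall fun ω => mul_comm _ _)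
    simp [hz]
  | inr c =>
    rcases Nat.eq_zero_or_pos k with rfl | hk
    · rw [hD0, zero_mul]
    · have hz : ∀ t : ℤ, ∫ ω, e t ω a * kappa u e (t - k) ω (Sum.inr c) ∂P = 0 := fun t =>
        he.uncorrelated t (t - k) (by omega) a c
      simp [hz]

theorem predictionError_ae_eq {G₀ G : Matrix (Fin p) (Fin m) (RatFunc ℝ)}
    {H₀ H : Matrix (Fin p) (Fin p) (RatFunc ℝ)}
    (hG₀ : IsStableMatrix G₀) (hH₀ : IsStableMatrix H₀) (hG : IsStableMatrix G)
    (hH : IsNoiseModel H) {y : ℤ → Ω → Fin p → ℝ}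
    (hy : ∀ t, ∀ᵐ ω ∂P, y t ω = filt G₀ u t ω + filt H₀ e t ω)
    (hK : ∀ c t, (fun ω => kappa u e t ω c) =ᵐ[P] K c t) (a : Fin p) (t : ℤ) :
    (fun ω => predictionError G H y u t ω a) =ᵐ[P]
      (K (Sum.inr a) + filterMat H⁻¹
        (filterMat (Matrix.fromCols G₀ H₀ - Matrix.fromCols G H) K) a) t := by
  have hHi := fun a b => (hH.stable_inv a b).hasSummableExpansion
  have hG₀s := fun a b => (hG₀ a b).hasSummableExpansion
  have hH₀s := fun a b => (hH₀ a b).hasSummableExpansion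
  have hGs := fun a b => (hG a b).hasSummableExpansion
  have hu : ∀ c t, (fun ω => u t ω c) =ᵐ[P] K (Sum.inl c) t := fun c t => hK (Sum.inl c) t
  have he : ∀ c t, (fun ω => e t ω c) =ᵐ[P] K (Sum.inr c) t := fun c t => hK (Sum.inr c) t
  have hY : ∀ b t, (fun ω => y t ω b) =ᵐ[P] filterMat (Matrix.fromCols G₀ H₀) K b t := by
    intro b t
    rw [filterMat_fromCols, Pi.add_apply, BoundedContinuousFunction.add_apply]
    filter_upwards [hy t, filt_ae_eq hG₀s hu b t, filt_ae_eq hH₀s he b t, Lp.coeFn_add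
      (filterMat G₀ (fun c => K (Sum.inl c)) b t) (filterMat H₀ (fun c => K (Sum.inr c)) b t)]
      with ω h1 h2 h3 h4
    rw [h1, h4, Pi.add_apply, Pi.add_apply, h2, h3]
  have h1s : ∀ a b, HasSummableExpansion ((1 - H⁻¹) a b) := by
    intro a b
    rw [Matrix.sub_apply, Matrix.one_apply]
    refine HasSummableExpansion.sub ?_ (hHi a b)
    split_ifs
    exacts [.one, .zero]
  have hHG : ∀ a b, HasSummableExpansion ((H⁻¹ * G) a b) := fun a b => by
    rw [Matrix.mul_apply]
    exact HasSummableExpansion.sum fun c _ => (hHi a c).mul (hGs c b)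
  have hid := congrFun (predictionError_filterMat hG₀ hH₀ hG hH K) a
  rw [Pi.add_apply] at hid
  rw [← hid, Pi.sub_apply, Pi.add_apply, BoundedContinuousFunction.sub_apply,
    BoundedContinuousFunction.add_apply]
  set Y := filterMat (Matrix.fromCols G₀ H₀) K with hYdef
  filter_upwards [hY a t, filt_ae_eq h1s hY a t, filt_ae_eq hHG hu a t,
    Lp.coeFn_sub (Y a t) (filterMat (1 - H⁻¹) Y a t +
      filterMat (H⁻¹ * G) (fun c => K (Sum.inl c)) a t),
    Lp.coeFn_add (filterMat (1 - H⁻¹) Y a t)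
      (filterMat (H⁻¹ * G) (fun c => K (Sum.inl c)) a t)] with ω h1 h2 h3 h4 h5
  rw [h4, Pi.sub_apply, h5, Pi.add_apply, ← h1, ← h2, ← h3]
  rfl

end

end PredErr

end

theorem proposition2
    {Ω : Type*} [MeasurableSpace Ω] (P : Measure Ω) [IsProbabilityMeasure P]
    {m p n : ℕ}
    -- the data generating system and its signals
    (G₀ : Matrix (Fin p) (Fin m) (RatFunc ℝ)) (H₀ : Matrix (Fin p) (Fin p) (RatFunc ℝ))
    (hG₀ : PredErr.IsStableMatrix G₀) (hH₀ : PredErr.IsNoiseModel H₀)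
    (y : ℤ → Ω → Fin p → ℝ) (u : ℤ → Ω → Fin m → ℝ) (e : ℤ → Ω → Fin p → ℝ)
    (Λ : Matrix (Fin p) (Fin p) ℝ) (he : PredErr.IsWhiteNoise P e Λ)
    (hκ : PredErr.IsQuasiStationary P (PredErr.kappa u e))
    (hue : ∀ s t : ℤ, s ≤ t → ∀ k i, ∫ ω, u s ω k * e t ω i ∂P = 0)
    (hy : ∀ t, ∀ᵐ ω ∂P, y t ω = PredErr.filt G₀ u t ω + PredErr.filt H₀ e t ω)
    -- the parametrized model, which contains the system
    (Θ : Set (Fin n → ℝ))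
    (G : (Fin n → ℝ) → Matrix (Fin p) (Fin m) (RatFunc ℝ))
    (H : (Fin n → ℝ) → Matrix (Fin p) (Fin p) (RatFunc ℝ))
    (hG : ∀ θ ∈ Θ, PredErr.IsStableMatrix (G θ))
    (hH : ∀ θ ∈ Θ, PredErr.IsNoiseModel (H θ))
    (hsys : ∃ θ₀ ∈ Θ, G θ₀ = G₀ ∧ H θ₀ = H₀)
    -- the weighting matrix of the cost
    (Q : Matrix (Fin p) (Fin p) ℝ) (hQ : Q.PosDef)
    -- the row of interest
    (j : Fin p) (hrow : PredErr.RowIndependent Θ (PredErr.modelMatrix G H) j)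
    -- the signals of the row, and their spectral density
    (S : Set (Fin m ⊕ Fin p))
    (hS : S = PredErr.nonzeroColumns Θ (PredErr.modelMatrix G H) j ∨
      S = PredErr.parametrizedColumns Θ (PredErr.modelMatrix G H) j)
    (Φ : ℝ → Matrix S S ℂ)
    (hΦ : PredErr.HasSpectralDensity P (PredErr.select S (PredErr.kappa u e)) Φ)
    (hpos : ∀ᵐ w ∂(volume.restrict (Set.Ioc (-Real.pi) Real.pi)), (Φ w).PosDef) :
    ∃ V : (Fin n → ℝ) → ℝ,
      PredErr.IsPredictionErrorCost P Θ G H Q y u V ∧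
      {r | ∃ θ ∈ Θ, IsMinOn V Θ θ ∧ PredErr.modelMatrix G H θ j = r} =
        {Matrix.fromCols G₀ H₀ j} := by

  classical
  have hH₀s := hH₀.stable
  obtain ⟨K, hK⟩ := hκ.exists_ae_eq
  obtain ⟨R, hR⟩ := hκ.covariance
  obtain ⟨θ₀, hθ₀, hGθ₀, hHθ₀⟩ := hsys
  set M := PredErr.modelMatrix G H with hM
  have hMθ₀ : M θ₀ = Matrix.fromCols G₀ H₀ := by rw [hM, PredErr.modelMatrix, hGθ₀, hHθ₀]
  have hsum : ∀ θ ∈ Θ, ∀ a c, PredErr.HasSummableExpansion ((Matrix.fromCols G₀ H₀ - M θ) a c) :=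
    fun θ hθ a c => (PredErr.hasSummableExpansion_fromCols hG₀ hH₀s a c).sub
      (PredErr.hasSummableExpansion_fromCols (hG θ hθ) (hH θ hθ).stable a c)
  have hinv : ∀ θ ∈ Θ, ∀ a b, PredErr.HasSummableExpansion ((H θ)⁻¹ a b) :=
    fun θ hθ a b => ((hH θ hθ).stable_inv a b).hasSummableExpansion
  have hD : ∀ θ ∈ Θ, ∀ a c, PredErr.HasSummableExpansion
      (((H θ)⁻¹ * (Matrix.fromCols G₀ H₀ - M θ)) a c) := fun θ hθ a c => by
    rw [Matrix.mul_apply]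
    exact PredErr.HasSummableExpansion.sum fun b _ => (hinv θ hθ a b).mul (hsum θ hθ b c)
  have hex : ∀ θ ∈ Θ, ∃ L : Fin p → Fin p → ℝ, ∀ a b, Tendsto (fun N => PredErr.avg N
      (PredErr.filterMat ((H θ)⁻¹ * (Matrix.fromCols G₀ H₀ - M θ)) K a)
      (PredErr.filterMat ((H θ)⁻¹ * (Matrix.fromCols G₀ H₀ - M θ)) K b)) atTop (𝓝 (L a b)) :=
    fun θ hθ => ⟨_, fun a b => PredErr.tendsto_avg_sum_filterOp (hD θ hθ a) (hD θ hθ b)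
      (hR.tendsto_avg hK)⟩
  choose! L hL using hex
  have hquad : ∀ θ ∈ Θ, Tendsto (fun N => ∑ a, ∑ b, Q a b * PredErr.avg N
      (PredErr.filterMat ((H θ)⁻¹ * (Matrix.fromCols G₀ H₀ - M θ)) K a)
      (PredErr.filterMat ((H θ)⁻¹ * (Matrix.fromCols G₀ H₀ - M θ)) K b)) atTop
      (𝓝 (∑ a, ∑ b, Q a b * L θ a b)) := fun θ hθ =>
    tendsto_finsetSum _ fun a _ => tendsto_finsetSum _ fun b _ => (hL θ hθ a b).const_mul _
  have hnn : ∀ θ ∈ Θ, 0 ≤ ∑ a, ∑ b, Q a b * L θ a b := fun θ hθ =>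
    ge_of_tendsto' (hquad θ hθ) fun N => PredErr.sum_posDef_avg_nonneg hQ N _
  have hL₀ : ∑ a, ∑ b, Q a b * L θ₀ a b = 0 := by
    refine tendsto_nhds_unique (hquad θ₀ hθ₀) ?_
    simp [hMθ₀, PredErr.filterMat, PredErr.filterOp_zero]
  -- Innovation power plus mismatch power. Values outside `Θ` are arbitrary and play no role.
  refine ⟨fun θ => ∑ a, ∑ b, Q a b * (Λ a b + L θ a b), fun θ hθ => ?_, ?_⟩
  · have hpe := PredErr.predictionError_ae_eq hG₀ hH₀s (hG θ hθ) (hH θ hθ) hy hK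
    rw [show Matrix.fromCols (G θ) (H θ) = M θ from rfl,
      ← PredErr.filterMat_mul (hinv θ hθ) (hsum θ hθ)] at hpe
    refine PredErr.hasGenExp_quadraticForm hpe Q fun a b => ?_
    have horth := PredErr.avg_noise_filterMat_eq_zero he hue hK (hD θ hθ)
      (PredErr.impulse_zero_mismatch hG₀ hH₀ (hG θ hθ) (hH θ hθ))
    refine ((PredErr.tendsto_avg_noise he hK a b).add (hL θ hθ a b)).congr fun N => ?_
    rw [PredErr.avg_comm N (_ + _), map_add, PredErr.avg_comm N _ (K (Sum.inr a)),
      PredErr.avg_comm N _ (PredErr.filterMat _ K a), map_add, map_add, horth,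
      PredErr.avg_comm N (PredErr.filterMat _ K a) (K (Sum.inr b)), horth, add_zero, zero_add]
  · have hVsplit : ∀ θ, ∑ a, ∑ b, Q a b * (Λ a b + L θ a b) =
        ∑ a, ∑ b, Q a b * Λ a b + ∑ a, ∑ b, Q a b * L θ a b := fun θ => by
      simp only [mul_add, Finset.sum_add_distrib]
    refine Set.eq_singleton_iff_unique_mem.2
      ⟨⟨θ₀, hθ₀, fun θ hθ => ?_, by rw [hMθ₀]⟩, ?_⟩
    · simp only [Set.mem_ofPred_eq, hVsplit, hL₀]
      linarith [hnn θ hθ]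
    · rintro r ⟨θ, hθ, hmin, rfl⟩
      have hmin₀ := hmin hθ₀
      simp only [Set.mem_ofPred_eq, hVsplit, hL₀] at hmin₀
      have hLθ : ∑ a, ∑ b, Q a b * L θ a b = 0 := le_antisymm (by linarith) (hnn θ hθ)
      have hneg := PredErr.isNegligible_of_tendsto_sum_posDef hQ (hLθ ▸ hquad θ hθ)
      -- Filtering by the stable `H θ` cancels the inverse that mixes the rows, and isolates the
      -- mismatch of row `j`.
      have hneg' := PredErr.IsNegligible.filterMat hneg
        (fun a b => ((hH θ hθ).stable a b).hasSummableExpansion) j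
      rw [← PredErr.filterMat_mul (fun a b => ((hH θ hθ).stable a b).hasSummableExpansion)
        (hD θ hθ), ← Matrix.mul_assoc, (hH θ hθ).mul_inv, Matrix.one_mul] at hneg'
      -- Since `θ₀` and `θ` both lie in `Θ`, an entry that is identically zero or free of parameters
      -- takes the same value at both.
      have hzero : ∀ c ∉ S, (Matrix.fromCols G₀ H₀ - M θ) j c = 0 := by
        intro c hc
        rw [Matrix.sub_apply, sub_eq_zero, ← hMθ₀]
        by_contra hne
        rcases hS with rfl | rfl
        · have h1 : M θ j c = 0 := by
            by_contra h
            exact hc ⟨θ, hθ, h⟩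
          exact hc ⟨θ₀, hθ₀, fun h => hne (h.trans h1.symm)⟩
        · exact hc ⟨θ₀, hθ₀, θ, hθ, hne⟩
      have hsel : PredErr.filterMat (Matrix.fromCols G₀ H₀ - M θ) K j =
          ∑ c : S, PredErr.filterOp ((Matrix.fromCols G₀ H₀ - M θ) j c) (K c) := by
        rw [PredErr.filterMat, Finset.sum_set_coe S (f := fun c =>
          PredErr.filterOp ((Matrix.fromCols G₀ H₀ - M θ) j c) (K c))]
        refine (Finset.sum_subset (Finset.subset_univ _) fun c _ hc => ?_).symm
        rw [hzero c fun h => hc (Set.mem_toFinset.2 h), PredErr.filterOp_zero]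
        rfl
      rw [hsel] at hneg'
      have hrow0 := PredErr.eq_zero_of_isNegligible_of_hasSpectralDensity
        (s := PredErr.select S (PredErr.kappa u e)) (S := fun c => K c) (fun c t => hK c t) hΦ hpos
        (fun c => hsum θ hθ j c) hneg'
      funext c
      by_cases hc : c ∈ S
      · exact (sub_eq_zero.1 (hrow0 ⟨c, hc⟩)).symm
      · exact (sub_eq_zero.1 (hzero c hc)).symm
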